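/- For a nonnegative integer $n$, let $b_9(n)$ be the number of $9$-regular partitions of $n$, that is, of partitions of $n$ none of whose parts is divisible by $9$ (so $b_9(0)=1$). For a positive integer $k$, let \[ f_k := \prod_{j=1}^{\infty} (1-q^{jk}), \] regarded as a formal power series in $q$ with integer coefficients. Then \[ \sum_{n=0}^{\infty} b_9(4n+3)\, q^n = 3\,\frac{f_2^2 f_6^2 f_9}{f_1^5}. \] Consequently, $b_9(4n+3) \equiv 0 \pmod 3$ for every nonnegative integer $n$. -/

import Mathlib

open scoped PowerSeries PowerSeries.WithPiTopology

/-- `regularPartitionCount t n` is the number `b_t(n)` of `t`-regular partitions of `n`, that is,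
of partitions of `n` none of whose parts is divisible by `t`. -/
def regularPartitionCount (t n : ℕ) : ℕ :=
  (Nat.Partition.restricted n (fun i => ¬ t ∣ i)).card

/-- The formal power series `f_k = ∏_{j ≥ 1} (1 - q^{jk})` with integer coefficients, for `k ≥ 1`.
The index `j` is shifted by one, and the infinite product is taken in the topology of
coefficientwise convergence, `ℤ` being discrete. -/
noncomputable def eulerProduct (k : ℕ) : ℤ⟦X⟧ :=
  ∏' j : ℕ, (1 - PowerSeries.X ^ ((j + 1) * k))

/-- For `k ≥ 1` the infinite product that defines `f_k` converges. -/
theorem multipliable_eulerProduct {k : ℕ} (hk : 0 < k) :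
    Multipliable fun j : ℕ => (1 - PowerSeries.X ^ ((j + 1) * k) : ℤ⟦X⟧) := by
  simp_rw [sub_eq_add_neg]
  apply PowerSeries.WithPiTopology.multipliable_one_add_of_tendsto_order_atTop_nhds_top
  simp_rw [PowerSeries.order_neg, PowerSeries.order_X_pow]
  refine ENat.tendsto_nhds_top_iff_natCast_lt.mpr fun n =>
    Filter.eventually_atTop.mpr ⟨n, fun m hm => ?_⟩
  norm_cast
  nlinarith

/-- For `k ≥ 1` the constant coefficient of `f_k` is `1`, so `f_k` is invertible in `ℤ⟦X⟧`. -/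
theorem constantCoeff_eulerProduct {k : ℕ} (hk : 0 < k) :
    PowerSeries.constantCoeff (eulerProduct k) = 1 := by
  rw [eulerProduct, (multipliable_eulerProduct hk).map_tprod _
    (PowerSeries.WithPiTopology.continuous_constantCoeff ℤ)]
  simp [hk.ne']

/-! The generating function of b₉ is f₉/f₁, so the theorem asks for two successive extractions of
the odd part of a series, each followed by replacing q² with q.

First extraction. Put ψ(q) = f₂²/f₁ and write f₉/f₁ = (f₉/f₂²) ψ(q). The 3-dissection of ψ
(`euler_psi_three_dissection`) turns this into an even series times f₉³/f₃, plus q f₁₈²/f₂². The odd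
part of f₃³/f₁ is q f₁₂³/f₄ (`euler_cube_div_sub`), taken here at q³; the two resulting terms are
recombined by the same 3-dissection at q². Hence b₉(2n+1) has generating function f₂² f₃ f₁₈/(f₁³
f₆).

Second extraction. Only f₃/f₁³ is not even up to a harmless factor after the substitution, and its
odd part is 3q f₄² f₆ f₁₂²/f₂⁷ (`euler_div_cube_sub`). This is the source of the factor 3.

Both odd parts come from writing f₃³/f₁ and f₁³/f₃, up to an even factor, as φ²ψψ with φ(q) = ∑
q^(n²), and 2-dissecting φ(q)² and ψ(q)ψ(q³). For F = f₁³/f₃ the even part collapses to f₄³/f₁₂; the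
square of the odd part is then (even part)² - F(q)F(-q). A relation of level 6 makes this a perfect
square, and a constant term fixes the sign of the root. The level 6 relation follows by multiplying
the 3-dissections of ψ and φ over the three cube roots of unity.

Product forms of theta series come from the Jacobi triple product; relations between theta series
come from splitting a sum over ℤ or ℤ² into cosets. -/

/-! ### X-adic convergence of sums and products -/

open PowerSeries in
theorem summable_of_X_pow_dvd {ι : Type*} {t : ι → ℂ⟦X⟧} (w : ι → ℕ)
    (hw : ∀ m, {i | w i ≤ m}.Finite) (h : ∀ i, X ^ w i ∣ t i) : Summable t := by
  rw [PowerSeries.WithPiTopology.summable_iff_summable_coeff]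
  intro d
  refine summable_of_hasFiniteSupport ((hw d).subset fun i hi => ?_)
  by_contra hd
  exact hi (X_pow_dvd_iff.mp (h i) d (not_le.mp hd))

open PowerSeries in
theorem X_pow_dvd_tsum_sub_sum {ι : Type*} {t : ι → ℂ⟦X⟧} (ht : Summable t) {m : ℕ}
    (s : Finset ι) (h : ∀ i ∉ s, X ^ m ∣ t i) : X ^ m ∣ ∑' i, t i - ∑ i ∈ s, t i := by
  rw [X_pow_dvd_iff]
  intro d hd
  have h1 := (PowerSeries.WithPiTopology.hasSum_iff_hasSum_coeff _).mp ht.hasSum d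
  have h2 : HasSum (fun i => coeff d (t i)) (∑ i ∈ s, coeff d (t i)) :=
    hasSum_sum_of_ne_finset_zero fun i hi => X_pow_dvd_iff.mp (h i hi) d hd
  rw [map_sub, h1.unique h2, map_sum, sub_self]

open PowerSeries in
theorem multipliable_one_add_of_X_pow_dvd {u : ℕ → ℂ⟦X⟧} (h : ∀ k, X ^ k ∣ u k) :
    Multipliable fun k => 1 + u k := by
  apply PowerSeries.WithPiTopology.multipliable_one_add_of_tendsto_order_atTop_nhds_top
  refine ENat.tendsto_nhds_top_iff_natCast_lt.mpr fun n =>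
    Filter.eventually_atTop.mpr ⟨n + 1, fun m hm => ?_⟩
  refine lt_of_lt_of_le ?_ (nat_le_order _ m (X_pow_dvd_iff.mp (h m)))
  exact_mod_cast hm

open PowerSeries in
-- Factors of index at least `m` are 1 modulo `X ^ m`, so the partial products are constant modulo
-- `X ^ m` from `N` on, and coefficients pass to the limit.
theorem X_pow_dvd_tprod_sub_prod {u : ℕ → ℂ⟦X⟧} (h : ∀ k, X ^ k ∣ u k) {m N : ℕ} (hN : m ≤ N) :
    X ^ m ∣ ∏' k, (1 + u k) - ∏ k ∈ Finset.range N, (1 + u k) := by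
  have h1 := (multipliable_one_add_of_X_pow_dvd h).hasProd.tendsto_prod_nat
  have h3 : ∀ n ≥ N, X ^ m ∣ ∏ k ∈ Finset.range n, (1 + u k) - ∏ k ∈ Finset.range N, (1 + u k) := by
    intro n hn
    induction n, hn using Nat.le_induction with
    | base => simp
    | succ n hn ih =>
      rw [Finset.prod_range_succ, mul_one_add, add_sub_right_comm]
      exact dvd_add ih (((pow_dvd_pow X (hN.trans hn)).trans (h n)).mul_left _)
  rw [X_pow_dvd_iff]
  intro d hd
  have h2 := (PowerSeries.WithPiTopology.tendsto_iff_coeff_tendsto ℂ _ _ _).mp h1 d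
  rw [map_sub, sub_eq_zero]
  refine tendsto_nhds_unique h2 (tendsto_const_nhds.congr' ?_)
  filter_upwards [Filter.eventually_ge_atTop N] with n hn
  have := X_pow_dvd_iff.mp (h3 n hn) d hd
  rw [map_sub, sub_eq_zero] at this
  exact this.symm

/-! ### Gaussian binomial coefficients and the finite `q`-binomial theorem -/

/-- The Gaussian binomial coefficient `[i + j choose i]` in the base `p`. -/
def gaussChoose {R : Type*} [CommRing R] (p : R) : ℕ → ℕ → R
  | 0, _ => 1
  | _ + 1, 0 => 1
  | i + 1, j + 1 => gaussChoose p i (j + 1) + p ^ (i + 1) * gaussChoose p (i + 1) j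

theorem gaussChoose_zero_right {R : Type*} [CommRing R] (p : R) (i : ℕ) :
    gaussChoose p i 0 = 1 := by
  cases i <;> simp [gaussChoose]

/-- The `q`-factorial formula with denominators cleared, so that nothing need be cancellable in `R`.
The induction uses 1 - p^(i+j+2) = (1 - p^(i+1)) + p^(i+1) (1 - p^(j+1)). -/
theorem gaussChoose_mul_prod_mul_prod {R : Type*} [CommRing R] (p : R) (i j : ℕ) :
    gaussChoose p i j * (∏ k ∈ Finset.range i, (1 - p ^ (k + 1))) *
      (∏ k ∈ Finset.range j, (1 - p ^ (k + 1))) = ∏ k ∈ Finset.range (i + j), (1 - p ^ (k + 1)) := by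
  induction i generalizing j with
  | zero => simp [gaussChoose]
  | succ i ih =>
    induction j with
    | zero => simp [gaussChoose]
    | succ j ihj =>
      have h1 := ih (j + 1)
      rw [show i + 1 + (j + 1) = (i + (j + 1)) + 1 by ring, Finset.prod_range_succ _ (i + (j + 1)),
        ← h1, gaussChoose]
      rw [show i + 1 + j = i + (j + 1) by ring, ← h1] at ihj
      simp only [Finset.prod_range_succ] at *
      linear_combination (p ^ (i + 1) * (1 - p ^ (j + 1))) * ihj

/-- The finite `q`-binomial theorem, in homogeneous form. -/
theorem prod_add_mul_pow_eq_sum_gaussChoose {R : Type*} [CommRing R] (p x y : R) (m : ℕ) :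
    ∏ k ∈ Finset.range m, (x + y * p ^ k) = ∑ ij ∈ Finset.HasAntidiagonal.antidiagonal m,
      gaussChoose p ij.1 ij.2 * (p ^ ij.2.choose 2 * x ^ ij.1 * y ^ ij.2) := by
  induction m with
  | zero => simp [gaussChoose]
  | succ m ih =>
    -- `B₁` and `B₂` are the two summands of the `q`-Pascal rule, extended by 0 to the boundary.
    -- They match the terms `x` and `y * p ^ m` of the new factor.
    let B₁ : ℕ → ℕ → R := fun i j => Nat.casesOn i 0 fun i => gaussChoose p i j
    let B₂ : ℕ → ℕ → R := fun i j => Nat.casesOn j 0 fun j => p ^ i * gaussChoose p i j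
    have hB : ∀ ij ∈ Finset.HasAntidiagonal.antidiagonal (m + 1),
        gaussChoose p ij.1 ij.2 * (p ^ ij.2.choose 2 * x ^ ij.1 * y ^ ij.2) =
        B₁ ij.1 ij.2 * (p ^ ij.2.choose 2 * x ^ ij.1 * y ^ ij.2) +
        B₂ ij.1 ij.2 * (p ^ ij.2.choose 2 * x ^ ij.1 * y ^ ij.2) := by
      rintro ⟨i, j⟩ hij
      rw [Finset.HasAntidiagonal.mem_antidiagonal] at hij
      rw [← add_mul]
      congr 1
      match i, j with
      | 0, 0 => simp at hij
      | 0, j + 1 => simp [B₁, B₂, gaussChoose]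
      | i + 1, 0 => simp [B₁, B₂, gaussChoose_zero_right]
      | i + 1, j + 1 => simp [B₁, B₂, gaussChoose]
    rw [Finset.sum_congr rfl hB, Finset.sum_add_distrib, Finset.Nat.sum_antidiagonal_succ,
      Finset.Nat.sum_antidiagonal_succ', Finset.prod_range_succ, ih, Finset.sum_mul]
    have z₁ : ∀ j, B₁ 0 j = 0 := fun _ => rfl
    have z₂ : ∀ i, B₂ i 0 = 0 := fun _ => rfl
    have s₁ : ∀ i j, B₁ (i + 1) j = gaussChoose p i j := fun _ _ => rfl
    have s₂ : ∀ i j, B₂ i (j + 1) = p ^ i * gaussChoose p i j := fun _ _ => rfl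
    simp only [z₁, z₂, s₁, s₂, zero_mul, zero_add]
    rw [← Finset.sum_add_distrib]
    refine Finset.sum_congr rfl ?_
    rintro ⟨i, j⟩ hij
    rw [Finset.HasAntidiagonal.mem_antidiagonal] at hij
    simp only at hij ⊢
    rw [← hij, Nat.choose_succ_succ' j 1, Nat.choose_one_right]
    ring

/-! ### The Jacobi triple product -/

theorem two_mul_toNat_mul_add_one (n : ℤ) : 2 * ((n * (n + 1) / 2).toNat : ℤ) = n * (n + 1) := by
  have h : 0 ≤ n * (n + 1) := by
    rcases le_or_gt 0 n with h | h <;> nlinarith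
  have h2 := (Int.even_mul_succ_self n).two_dvd
  omega

theorem two_mul_toNat_mul_sub_one (n : ℤ) : 2 * ((n * (n - 1) / 2).toNat : ℤ) = n * (n - 1) := by
  have h := two_mul_toNat_mul_add_one (n - 1)
  rwa [sub_add_cancel, mul_comm (n - 1)] at h

/-- The general term of Ramanujan's theta series `f(a, b)`. -/
noncomputable def thetaTerm (a b : ℂ⟦X⟧) (n : ℤ) : ℂ⟦X⟧ :=
  a ^ (n * (n + 1) / 2).toNat * b ^ (n * (n - 1) / 2).toNat

theorem prod_mul_prod_eq_sum_gaussChoose_mul_thetaTerm {a b : ℂ⟦X⟧} (hab : a * b ≠ 0) (N : ℕ) :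
    (∏ k ∈ Finset.range N, (1 + a * (a * b) ^ k)) * (∏ k ∈ Finset.range N, (1 + b * (a * b) ^ k)) =
      ∑ ij ∈ Finset.HasAntidiagonal.antidiagonal (2 * N),
        gaussChoose (a * b) ij.1 ij.2 * thetaTerm a b ((ij.2 : ℤ) - N) := by
  have ha : a ≠ 0 := left_ne_zero_of_mul hab
  -- With p = ab, the last N of the 2N factors are p^N (1 + a p^k), and the first N are p^N + a p^k
  -- = a p^k (1 + b p^(N-1-k)). Dividing by the common monomial gives the symmetric finite form of
  -- the triple product.
  have h := prod_add_mul_pow_eq_sum_gaussChoose (a * b) ((a * b) ^ N) a (2 * N)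
  rw [two_mul, Finset.prod_range_add, ← two_mul] at h
  have h1 : ∏ k ∈ Finset.range N, ((a * b) ^ N + a * (a * b) ^ (N + k)) =
      (a * b) ^ (N * N) * ∏ k ∈ Finset.range N, (1 + a * (a * b) ^ k) := by
    rw [Finset.prod_congr rfl fun k _ => show (a * b) ^ N + a * (a * b) ^ (N + k) =
      (a * b) ^ N * (1 + a * (a * b) ^ k) by ring, Finset.prod_mul_distrib, Finset.prod_const,
      Finset.card_range, pow_mul]
  have h2 : ∏ k ∈ Finset.range N, ((a * b) ^ N + a * (a * b) ^ k) =
      a ^ N * (a * b) ^ (N.choose 2) * ∏ k ∈ Finset.range N, (1 + b * (a * b) ^ k) := by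
    rw [← Finset.prod_range_reflect (fun k => 1 + b * (a * b) ^ k), Nat.choose_two_right,
      ← Finset.sum_range_id, ← Finset.prod_pow_eq_pow_sum,
      show a ^ N = ∏ _k ∈ Finset.range N, a by simp, ← Finset.prod_mul_distrib,
      ← Finset.prod_mul_distrib]
    refine Finset.prod_congr rfl fun k hk => ?_
    obtain ⟨l, hl⟩ := Nat.exists_eq_add_of_lt (Finset.mem_range.mp hk)
    rw [show N - 1 - k = l by omega, show (a * b) ^ N = (a * b) ^ (k + l + 1) by rw [hl]]
    ring
  rw [h1, h2] at h
  have hC : a ^ N * (a * b) ^ (N.choose 2) * (a * b) ^ (N * N) ≠ 0 := by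
    exact mul_ne_zero (mul_ne_zero (pow_ne_zero _ ha) (pow_ne_zero _ hab)) (pow_ne_zero _ hab)
  refine mul_left_cancel₀ hC ?_
  rw [Finset.mul_sum]
  refine Eq.trans (by ring) (h.trans (Finset.sum_congr rfl ?_))
  rintro ⟨i, j⟩ hij
  rw [Finset.HasAntidiagonal.mem_antidiagonal] at hij
  simp only at hij ⊢
  suffices h : (a * b) ^ j.choose 2 * ((a * b) ^ N) ^ i * a ^ j = a ^ N * (a * b) ^ N.choose 2 *
      (a * b) ^ (N * N) * thetaTerm a b ((j : ℤ) - N) by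
    rw [h]
    ring
  have e1 := two_mul_toNat_mul_add_one ((j : ℤ) - N)
  have e2 := two_mul_toNat_mul_sub_one ((j : ℤ) - N)
  have hc : ∀ k : ℕ, 2 * (k.choose 2 : ℤ) = k * (k - 1) := by
    intro k
    induction k with
    | zero => simp
    | succ k ih =>
      rw [Nat.choose_succ_succ' k 1, Nat.choose_one_right]
      push_cast
      linear_combination ih
  have hi : (i : ℤ) = 2 * N - j := by omega
  rw [thetaTerm]
  generalize ((j - N : ℤ) * ((j : ℤ) - N + 1) / 2).toNat = u at *
  generalize ((j - N : ℤ) * ((j : ℤ) - N - 1) / 2).toNat = v at *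
  have ea : j.choose 2 + N * i + j = N + N.choose 2 + N * N + u := by
    zify
    have := hc j
    have := hc N
    rw [hi]
    linarith
  have eb : j.choose 2 + N * i = N.choose 2 + N * N + v := by
    zify
    have := hc j
    have := hc N
    rw [hi]
    linarith
  calc (a * b) ^ j.choose 2 * ((a * b) ^ N) ^ i * a ^ j
      = a ^ (j.choose 2 + N * i + j) * b ^ (j.choose 2 + N * i) := by ring
    _ = _ := by rw [ea, eb]; ring

/-- Both exponents n(n ± 1)/2 are at least |n| - 1, so (ab)^(|n|-1) divides the term. Only `a * b`
is required to have zero constant term, because ψ is obtained from `b = 1`. -/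
theorem X_pow_dvd_thetaTerm {a b : ℂ⟦X⟧} (hab : PowerSeries.constantCoeff (a * b) = 0) (n : ℤ) :
    PowerSeries.X ^ (n.natAbs - 1) ∣ thetaTerm a b n := by
  have h := pow_dvd_pow_of_dvd (PowerSeries.X_dvd_iff.mpr hab) (n.natAbs - 1)
  refine h.trans ?_
  rw [mul_pow, thetaTerm]
  have e1 := two_mul_toNat_mul_add_one n
  have e2 := two_mul_toNat_mul_sub_one n
  refine mul_dvd_mul (pow_dvd_pow _ ?_) (pow_dvd_pow _ ?_)
  · generalize (n * (n + 1) / 2).toNat = u at *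
    zify
    by_contra! hu
    rcases Int.natAbs_eq n with h | h <;> generalize n.natAbs = k at * <;> subst h <;>
      rcases k with _ | _ | k <;> push_cast at * <;> simp at * <;> nlinarith
  · generalize (n * (n - 1) / 2).toNat = u at *
    zify
    by_contra! hu
    rcases Int.natAbs_eq n with h | h <;> generalize n.natAbs = k at * <;> subst h <;>
      rcases k with _ | _ | k <;> push_cast at * <;> simp at * <;> nlinarith

theorem finite_natAbs_sub_one_le (m : ℕ) : {n : ℤ | n.natAbs - 1 ≤ m}.Finite :=
  (Set.finite_Icc (-(m + 1) : ℤ) (m + 1)).subset fun n hn => by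
    simp only [Set.mem_ofPred_eq, Set.mem_Icc] at *
    omega

theorem summable_thetaTerm {a b : ℂ⟦X⟧} (hab : PowerSeries.constantCoeff (a * b) = 0) :
    Summable (thetaTerm a b) :=
  summable_of_X_pow_dvd _ finite_natAbs_sub_one_le (X_pow_dvd_thetaTerm hab)

open PowerSeries in
theorem X_pow_dvd_mul_pow {p : ℂ⟦X⟧} (hp : constantCoeff p = 0) (a : ℂ⟦X⟧) (k : ℕ) :
    X ^ k ∣ a * p ^ k :=
  (pow_dvd_pow_of_dvd (X_dvd_iff.mpr hp) k).mul_left a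

theorem eq_of_forall_X_pow_dvd_sub {f g : ℂ⟦X⟧} (h : ∀ m, PowerSeries.X ^ m ∣ f - g) : f = g := by
  ext d
  have := PowerSeries.X_pow_dvd_iff.mp (h (d + 1)) d d.lt_succ_self
  rwa [map_sub, sub_eq_zero] at this

open PowerSeries in
/-- The Jacobi triple product identity, in Ramanujan's form. -/
theorem tsum_thetaTerm_eq_tprod {a b : ℂ⟦X⟧} (hp : constantCoeff (a * b) = 0) (hab : a * b ≠ 0) :
    ∑' n, thetaTerm a b n = (∏' k : ℕ, (1 + a * (a * b) ^ k)) * (∏' k : ℕ, (1 + b * (a * b) ^ k)) *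
      ∏' k : ℕ, (1 + -(a * b) * (a * b) ^ k) := by
  refine eq_of_forall_X_pow_dvd_sub fun m => ?_
  -- The comparison is made modulo `X ^ m`. If `i` and `j` are both at least `m`, the Gaussian
  -- binomial is the inverse of `P`. Otherwise |j - N| > N - m > m, so the theta term vanishes; so
  -- do all theta terms with |n| > N, which are absent from the finite sum.
  set N := 2 * m + 2
  let π := Ideal.Quotient.mk (Ideal.span {(X : ℂ⟦X⟧) ^ m})
  have hπ : ∀ f g : ℂ⟦X⟧, X ^ m ∣ f - g ↔ π f = π g := fun f g => by
    rw [Ideal.Quotient.eq, Ideal.mem_span_singleton]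
  have hprod : ∀ c : ℂ⟦X⟧, ∀ n ≥ m, π (∏' k : ℕ, (1 + c * (a * b) ^ k)) =
      π (∏ k ∈ Finset.range n, (1 + c * (a * b) ^ k)) := fun c n hn =>
    (hπ _ _).mp (X_pow_dvd_tprod_sub_prod (fun k => X_pow_dvd_mul_pow hp c k) hn)
  set P := ∏' k : ℕ, (1 + -(a * b) * (a * b) ^ k)
  have hP : ∀ n ≥ m, π (∏ k ∈ Finset.range n, (1 - (a * b) ^ (k + 1))) = π P := fun n hn => by
    rw [hprod _ n hn]
    congr 1
    exact Finset.prod_congr rfl fun k _ => by ring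
  have hunit : IsUnit (π P) := by
    rw [← hP m le_rfl]
    refine IsUnit.map π (isUnit_iff_constantCoeff.mpr ?_)
    simp [map_prod, hp]
  have hgauss : ∀ i ≥ m, ∀ j ≥ m, π (gaussChoose (a * b) i j) * π P = 1 := fun i hi j hj => by
    have := congrArg π (gaussChoose_mul_prod_mul_prod (a * b) i j)
    rw [map_mul, map_mul, hP i hi, hP j hj, hP _ (hi.trans (Nat.le_add_right i j))] at this
    exact hunit.mul_right_cancel (this.trans (one_mul _).symm)
  rw [hπ, map_mul, map_mul, hprod a N (by omega), hprod b N (by omega), ← map_mul,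
    prod_mul_prod_eq_sum_gaussChoose_mul_thetaTerm hab, map_sum, Finset.sum_mul]
  have hinj : Set.InjOn (fun ij : ℕ × ℕ => (ij.2 : ℤ) - N)
      (Finset.HasAntidiagonal.antidiagonal (2 * N)) := by
    rintro ⟨i, j⟩ h1 ⟨i', j'⟩ h2 h
    simp at h1 h2 h
    ext <;> simp <;> omega
  have hsum : π (∑' n, thetaTerm a b n) = π (∑ n ∈ (Finset.HasAntidiagonal.antidiagonal (2 * N)).image
      (fun ij : ℕ × ℕ => (ij.2 : ℤ) - N), thetaTerm a b n) := by
    refine (hπ _ _).mp (X_pow_dvd_tsum_sub_sum (summable_thetaTerm hp) _ fun n hn => ?_)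
    refine (pow_dvd_pow X ?_).trans (X_pow_dvd_thetaTerm hp n)
    by_contra! hlt
    refine hn (Finset.mem_image.mpr ⟨((N - n).toNat, (N + n).toNat), ?_, ?_⟩)
    · simp only [Finset.HasAntidiagonal.mem_antidiagonal]
      omega
    · simp only
      omega
  rw [hsum, Finset.sum_image hinj, map_sum]
  refine Finset.sum_congr rfl ?_
  rintro ⟨i, j⟩ hij
  rw [Finset.HasAntidiagonal.mem_antidiagonal] at hij
  simp only at hij ⊢
  rw [map_mul, mul_right_comm]
  by_cases h : m ≤ i ∧ m ≤ j
  · rw [hgauss i h.1 j h.2, one_mul]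
  · have h0 : π (thetaTerm a b ((j : ℤ) - N)) = 0 := by
      rw [← map_zero π, ← hπ, sub_zero]
      exact (pow_dvd_pow X (by omega)).trans (X_pow_dvd_thetaTerm hp _)
    rw [h0, mul_zero]

/-! ### Manipulation of infinite `q`-products -/

/-- The infinite product `∏ (1 + c p ^ k)` over `k ≥ 0`. -/
noncomputable def qProd (c p : ℂ⟦X⟧) : ℂ⟦X⟧ := ∏' k : ℕ, (1 + c * p ^ k)

section qProd

open PowerSeries Filter

variable {c p : ℂ⟦X⟧}

theorem tendsto_qProd (hp : constantCoeff p = 0) :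
    Tendsto (fun N => ∏ k ∈ Finset.range N, (1 + c * p ^ k)) atTop (nhds (qProd c p)) :=
  (multipliable_one_add_of_X_pow_dvd (X_pow_dvd_mul_pow hp c)).hasProd.tendsto_prod_nat

theorem qProd_eq_prod_range (hp : constantCoeff p = 0) {m : ℕ} (hm : 0 < m) :
    qProd c p = ∏ i ∈ Finset.range m, qProd (c * p ^ i) (p ^ m) := by
  have hpm : constantCoeff (p ^ m) = 0 := by rw [map_pow, hp, zero_pow hm.ne']
  have h1 := tendsto_finsetProd (Finset.range m) fun i _ => tendsto_qProd (c := c * p ^ i) hpm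
  have h2 := (tendsto_qProd (c := c) hp).comp
    (tendsto_id.const_mul_atTop' hm : Tendsto (fun N => m * N) atTop atTop)
  refine tendsto_nhds_unique (h2.congr fun N => ?_) h1
  simp only [Function.comp_apply]
  induction N with
  | zero => simp
  | succ N ih =>
    simp only [Finset.prod_range_succ _ N, Finset.prod_mul_distrib, ← ih]
    rw [Nat.mul_succ, Finset.prod_range_add]
    congr 1
    exact Finset.prod_congr rfl fun k _ => by ring

theorem qProd_two (hp : constantCoeff p = 0) :
    qProd c p = qProd c (p ^ 2) * qProd (c * p) (p ^ 2) := by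
  simp [qProd_eq_prod_range (m := 2) hp (by decide), Finset.prod_range_succ]

theorem qProd_three (hp : constantCoeff p = 0) :
    qProd c p = qProd c (p ^ 3) * qProd (c * p) (p ^ 3) * qProd (c * p ^ 2) (p ^ 3) := by
  simp [qProd_eq_prod_range (m := 3) hp (by decide), Finset.prod_range_succ]

theorem qProd_mul_qProd_neg (hp : constantCoeff p = 0) :
    qProd c p * qProd (-c) p = qProd (-c ^ 2) (p ^ 2) := by
  have hp2 : constantCoeff (p ^ 2) = 0 := by simp [hp]
  refine tendsto_nhds_unique (((tendsto_qProd hp).mul (tendsto_qProd hp)).congr fun N => ?_)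
    (tendsto_qProd hp2)
  rw [← Finset.prod_mul_distrib]
  exact Finset.prod_congr rfl fun k _ => by ring

/-- Factor by factor this is (1 - t)(1 - wt)(1 - w²t) = 1 - t³. -/
theorem qProd_cube {w : ℂ} (hw : 1 + w + w ^ 2 = 0) (hp : constantCoeff p = 0) :
    qProd (-c) p * qProd (-(C w * c)) p * qProd (-(C w ^ 2 * c)) p = qProd (-c ^ 3) (p ^ 3) := by
  have hp3 : constantCoeff (p ^ 3) = 0 := by simp [hp]
  have hC : 1 + C w + C w ^ 2 = (0 : ℂ⟦X⟧) := by
    rw [← map_pow, ← map_one (C (R := ℂ)), ← map_add, ← map_add, hw, map_zero]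
  refine tendsto_nhds_unique ((((tendsto_qProd hp).mul (tendsto_qProd hp)).mul
    (tendsto_qProd hp)).congr fun N => ?_) (tendsto_qProd hp3)
  rw [← Finset.prod_mul_distrib, ← Finset.prod_mul_distrib]
  refine Finset.prod_congr rfl fun k _ => ?_
  rw [← pow_mul, mul_comm 3 k, pow_mul]
  generalize p ^ k = y
  generalize C w = v at *
  linear_combination (-c * y + v * (c * y) ^ 2 - (v - 1) * (c * y) ^ 3) * hC

/-- The factor `k = 0` is split off. Here `c` may have a nonzero constant term: at `c = 1` the
factor is the 2 in `thetaPsi_mul`. -/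
theorem qProd_eq_one_add_mul (hp : constantCoeff p = 0) :
    qProd c p = (1 + c) * qProd (c * p) p := by
  refine tendsto_nhds_unique ((tendsto_qProd hp).comp (tendsto_add_atTop_nat 1))
    (((tendsto_qProd hp).const_mul (1 + c)).congr fun N => ?_)
  simp only [Function.comp_apply]
  rw [Finset.prod_range_succ', pow_zero, mul_one, mul_comm]
  congr 1
  exact Finset.prod_congr rfl fun k _ => by ring

theorem constantCoeff_qProd (hc : constantCoeff c = 0) (hp : constantCoeff p = 0) :
    constantCoeff (qProd c p) = 1 := by
  rw [qProd_eq_one_add_mul hp]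
  have h := (((WithPiTopology.continuous_constantCoeff ℂ).tendsto _).comp
    (tendsto_qProd (c := c * p) hp))
  have : constantCoeff (qProd (c * p) p) = 1 :=
    tendsto_nhds_unique (h.congr fun N => by simp [map_prod, hp]) tendsto_const_nhds
  simp [hc, this]

end qProd

/-! ### Euler products and product forms of theta series -/

/-- Euler's product `∏ (1 - q ^ j)` over `j ≥ 1`, for a power series `q`. -/
noncomputable def euler (q : ℂ⟦X⟧) : ℂ⟦X⟧ := qProd (-q) q

/-- The theta series `∑ q ^ (n ^ 2)` over the integers. -/
noncomputable def thetaPhi (q : ℂ⟦X⟧) : ℂ⟦X⟧ := ∑' n : ℤ, q ^ (n * n).toNat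

/-- The theta series `∑ q ^ (n (n + 1) / 2)` over the integers, twice Ramanujan's `ψ`. -/
noncomputable def thetaPsi (q : ℂ⟦X⟧) : ℂ⟦X⟧ := ∑' n : ℤ, q ^ (n * (n + 1) / 2).toNat

/-- The theta series `f(q ^ 2, q)`. -/
noncomputable def thetaA (q : ℂ⟦X⟧) : ℂ⟦X⟧ := ∑' n : ℤ, q ^ (n * (3 * n + 1) / 2).toNat

/-- The theta series `f(q ^ 5, q)`. -/
noncomputable def thetaOmega (q : ℂ⟦X⟧) : ℂ⟦X⟧ := ∑' n : ℤ, q ^ (3 * (n * n) + 2 * n).toNat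

section products

open PowerSeries

variable {q : ℂ⟦X⟧}

theorem constantCoeff_euler (hq : constantCoeff q = 0) : constantCoeff (euler q) = 1 :=
  constantCoeff_qProd (by simp [hq]) hq

theorem euler_ne_zero (hq : constantCoeff q = 0) : euler q ≠ 0 := fun h => by
  have := constantCoeff_euler hq
  simp [h] at this

theorem tsum_thetaTerm {a b : ℂ⟦X⟧} (hp : constantCoeff (a * b) = 0) (hab : a * b ≠ 0) :
    ∑' n, thetaTerm a b n = qProd a (a * b) * qProd b (a * b) * euler (a * b) :=
  tsum_thetaTerm_eq_tprod hp hab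

theorem euler_eq_mul (hq : constantCoeff q = 0) : euler q = qProd (-q) (q ^ 2) * euler (q ^ 2) := by
  rw [euler, qProd_two hq, euler, neg_mul, ← sq]

theorem qProd_self_mul_euler (hq : constantCoeff q = 0) : qProd q q * euler q = euler (q ^ 2) := by
  rw [euler, qProd_mul_qProd_neg hq, euler]

/-- The even factors of f(q) and f(-q) coincide, while the odd ones multiply to ∏ (1 - q^(4k+2)) =
f₂/f₄. -/
theorem euler_neg_mul (hq : constantCoeff q = 0) :
    euler (-q) * euler q * euler (q ^ 4) = euler (q ^ 2) ^ 3 := by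
  have hq2 : constantCoeff (q ^ 2) = 0 := by simp [hq]
  have h1 := euler_eq_mul hq
  have h2 := euler_eq_mul (q := -q) (by simp [hq])
  have h3 := euler_eq_mul hq2
  have h4 := qProd_mul_qProd_neg (c := q) hq2
  rw [neg_sq, neg_neg] at h2
  rw [← pow_mul] at h3 h4
  rw [← h4] at h3
  rw [h1, h2, show 4 = 2 * 2 from rfl]
  linear_combination (-euler (q ^ 2) ^ 2) * h3

/-- Factors with exponent divisible by 3 are the same at q, wq, w²q and give f₃³. The remaining ones
multiply in threes to 1 - q^(3k) with k prime to 3, which gives f₃/f₉. -/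
theorem euler_cube {w : ℂ} (hw : 1 + w + w ^ 2 = 0) (hq : constantCoeff q = 0) :
    euler q * euler (C w * q) * euler (C w ^ 2 * q) * euler (q ^ 9) = euler (q ^ 3) ^ 4 := by
  have hq3 : constantCoeff (q ^ 3) = 0 := by simp [hq]
  have hw3 : (C w : ℂ⟦X⟧) ^ 3 = 1 := by
    rw [← map_pow, ← map_one (C (R := ℂ))]
    congr 1
    linear_combination (w - 1) * hw
  have h0 : ∀ r : ℂ⟦X⟧, constantCoeff r = 0 → euler r =
      qProd (-r) (r ^ 3) * qProd (-(r ^ 2)) (r ^ 3) * euler (r ^ 3) := fun r hr => by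
    rw [euler, qProd_three hr, euler]
    congr 3 <;> ring
  have h1 := h0 q hq
  have h2 := h0 (C w * q) (by simp [hq])
  have h3 := h0 (C w ^ 2 * q) (by simp [hq])
  have h4 := h0 (q ^ 3) hq3
  rw [mul_pow, mul_pow, hw3, one_mul] at h2
  rw [mul_pow, mul_pow, ← pow_mul, ← pow_mul, show 2 * 3 = 3 * 2 by rfl, pow_mul _ 3, hw3, one_pow,
    one_mul, show 2 * 2 = 3 + 1 from rfl, pow_add, hw3, one_mul, pow_one] at h3
  have c1 := qProd_cube (c := q) hw hq3
  have c2 := qProd_cube (c := q ^ 2) hw hq3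
  rw [← pow_mul, ← pow_mul] at h4 c2
  rw [← pow_mul] at c1
  norm_num at h4 c1 c2
  rw [← c1, ← c2] at h4
  rw [h1, h2, h3]
  linear_combination (-euler (q ^ 3) ^ 3) * h4

theorem thetaPhi_neg_mul (hq : constantCoeff q = 0) (hq0 : q ≠ 0) :
    thetaPhi (-q) * euler (q ^ 2) = euler q ^ 2 := by
  have h := tsum_thetaTerm (a := -q) (b := -q) (by simp [hq]) (by simpa using hq0)
  rw [neg_mul_neg, ← sq] at h
  have h1 : thetaPhi (-q) = ∑' n, thetaTerm (-q) (-q) n := by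
    refine tsum_congr fun n => ?_
    rw [thetaTerm, ← pow_add]
    congr 1
    have e1 := two_mul_toNat_mul_add_one n
    have e2 := two_mul_toNat_mul_sub_one n
    have e3 := Int.toNat_of_nonneg (mul_self_nonneg n)
    zify
    linarith
  rw [h1, h, euler_eq_mul hq]
  ring_nf

theorem thetaPsi_mul (hq : constantCoeff q = 0) (hq0 : q ≠ 0) :
    thetaPsi q * euler q = 2 * euler (q ^ 2) ^ 2 := by
  have h := tsum_thetaTerm (a := q) (b := 1) (by simp [hq]) (by simpa using hq0)
  rw [mul_one, qProd_eq_one_add_mul (c := 1) hq, one_mul] at h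
  have h1 : thetaPsi q = ∑' n, thetaTerm q 1 n :=
    tsum_congr fun n => by rw [thetaTerm, one_pow, mul_one]
  rw [h1, h, ← qProd_self_mul_euler hq]
  ring

theorem thetaA_mul (hq : constantCoeff q = 0) (hq0 : q ≠ 0) :
    thetaA q * (euler q * euler (q ^ 6)) = euler (q ^ 2) * euler (q ^ 3) ^ 2 := by
  have hq3 : constantCoeff (q ^ 3) = 0 := by simp [hq]
  have h := tsum_thetaTerm (a := q ^ 2) (b := q) (by simp [hq]) (by simpa using hq0)
  rw [← pow_succ] at h
  have h1 : thetaA q = ∑' n, thetaTerm (q ^ 2) q n := by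
    refine tsum_congr fun n => ?_
    rw [thetaTerm, ← pow_mul, ← pow_add]
    congr 1
    have e1 := two_mul_toNat_mul_add_one n
    have e2 := two_mul_toNat_mul_sub_one n
    generalize (n * (n + 1) / 2).toNat = u at *
    generalize (n * (n - 1) / 2).toNat = v at *
    have : n * (3 * n + 1) = 2 * (2 * u + v) := by linarith
    rw [this]
    omega
  -- Splitting ∏ (1 + q^k) by k modulo 3 shows that the residues 1 and 2, the ones in the triple
  -- product, contribute (f₂/f₁)/(f₆/f₃).
  have h2 := qProd_three (c := q) hq
  have h3 := qProd_self_mul_euler hq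
  have h4 := qProd_self_mul_euler hq3
  rw [← pow_mul] at h4
  rw [← sq, ← pow_succ'] at h2
  norm_num at h h4
  rw [h1, h, ← h3, h2, ← h4]
  ring

theorem thetaOmega_neg_mul (hq : constantCoeff q = 0) (hq0 : q ≠ 0) :
    thetaOmega (-q) * (euler (q ^ 2) * euler (q ^ 3)) = euler q * euler (q ^ 6) ^ 2 := by
  have hq2 : constantCoeff (q ^ 2) = 0 := by simp [hq]
  have hq3 : constantCoeff (q ^ 3) = 0 := by simp [hq]
  have h := tsum_thetaTerm (a := (-q) ^ 5) (b := -q) (by simp [hq]) (by simpa using hq0)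
  rw [← pow_succ, Odd.neg_pow (by decide), Even.neg_pow (by decide)] at h
  have h1 : thetaOmega (-q) = ∑' n, thetaTerm ((-q) ^ 5) (-q) n := by
    refine tsum_congr fun n => ?_
    rw [thetaTerm, ← pow_mul, ← pow_add]
    congr 1
    have e1 := two_mul_toNat_mul_add_one n
    have e2 := two_mul_toNat_mul_sub_one n
    generalize (n * (n + 1) / 2).toNat = u at *
    generalize (n * (n - 1) / 2).toNat = v at *
    have : 3 * (n * n) + 2 * n = 5 * u + v := by linarith
    rw [this]
    omega
  -- The triple product carries the exponents 1 and 5 modulo 6: all odd exponents, f₁/f₂, without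
  -- the odd multiples of 3, f₃/f₆.
  have h2 := qProd_three (c := -q) hq2
  have h3 := euler_eq_mul hq
  have h4 := euler_eq_mul hq3
  rw [Odd.neg_pow (by decide)] at h1
  rw [neg_mul, neg_mul, ← pow_succ', ← pow_mul, ← pow_mul, ← pow_succ'] at h2
  rw [← pow_mul] at h4
  norm_num at h h2 h4
  rw [h1, h, h3, h2, h4]
  ring

end products

/-! ### Series with integer exponents over an arbitrary index type -/

/-- The series `∑ q ^ (e i)` over an arbitrary index type. -/
noncomputable def expSum {ι : Type*} (e : ι → ℤ) (q : ℂ⟦X⟧) : ℂ⟦X⟧ := ∑' i, q ^ (e i).toNat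

/-- Nonnegative exponents that take every value finitely often. -/
def ProperExp {ι : Type*} (e : ι → ℤ) : Prop := (∀ i, 0 ≤ e i) ∧ ∀ m : ℕ, {i | e i ≤ m}.Finite

section expSum

open PowerSeries

variable {ι κ : Type*} {e : ι → ℤ} {f : κ → ℤ} {q : ℂ⟦X⟧}

theorem ProperExp.comp (he : ProperExp e) {i : κ → ι} (hi : i.Injective) : ProperExp (e ∘ i) :=
  ⟨fun k => he.1 (i k), fun m =>
    ((he.2 m).preimage (f := i) hi.injOn).subset fun _ hk => hk⟩

theorem ProperExp.const_mul (he : ProperExp e) {k : ℕ} (hk : 0 < k) :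
    ProperExp fun i => (k : ℤ) * e i :=
  ⟨fun i => mul_nonneg (by positivity) (he.1 i), fun m => (he.2 m).subset fun i hi => by
    simp only [Set.mem_ofPred_eq] at *
    have := he.1 i
    nlinarith⟩

theorem ProperExp.add (he : ProperExp e) (hf : ProperExp f) :
    ProperExp fun x : ι × κ => e x.1 + f x.2 :=
  ⟨fun x => add_nonneg (he.1 _) (hf.1 _), fun m =>
    ((he.2 m).prod (hf.2 m)).subset fun x hx => by
      simp only [Set.mem_ofPred_eq, Set.mem_prod] at *
      have := he.1 x.1
      have := hf.1 x.2
      omega⟩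

theorem properExp_of_natAbs_le {e : ℤ → ℤ} (h0 : ∀ n, 0 ≤ e n) (h : ∀ n, |n| ≤ e n + 1) :
    ProperExp e :=
  ⟨h0, fun m => (Set.finite_Icc (-(m + 1) : ℤ) (m + 1)).subset fun n hn => by
    simp only [Set.mem_ofPred_eq, Set.mem_Icc] at *
    have := abs_le.mp (h n)
    omega⟩

theorem ProperExp.summable (he : ProperExp e) (hq : constantCoeff q = 0) :
    Summable fun i => q ^ (e i).toNat :=
  summable_of_X_pow_dvd (fun i => (e i).toNat) (fun m => (he.2 m).subset fun i hi => by
    simp only [Set.mem_ofPred_eq] at *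
    omega) fun i => pow_dvd_pow_of_dvd (X_dvd_iff.mpr hq) _

theorem expSum_pow (k : ℕ) : expSum e (q ^ k) = expSum (fun i => (k : ℤ) * e i) q := by
  refine tsum_congr fun i => ?_
  rw [← pow_mul]
  congr 1
  rcases le_total 0 (e i) with h | h
  · rw [Int.toNat_mul k.cast_nonneg h, Int.toNat_natCast]
  · rw [Int.toNat_of_nonpos h, Int.toNat_of_nonpos (mul_nonpos_of_nonneg_of_nonpos k.cast_nonneg h),
      mul_zero]

theorem expSum_mul (he : ProperExp e) (hf : ProperExp f) (hq : constantCoeff q = 0) :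
    expSum e q * expSum f q = expSum (fun x : ι × κ => e x.1 + f x.2) q := by
  have h : ∀ x : ι × κ, q ^ (e x.1).toNat * q ^ (f x.2).toNat = q ^ (e x.1 + f x.2).toNat :=
    fun x => by rw [← pow_add, Int.toNat_add (he.1 _) (hf.1 _)]
  rw [expSum, expSum, Summable.tsum_mul_tsum (he.summable hq) (hf.summable hq)]
  · exact tsum_congr h
  · exact ((he.add hf).summable hq).congr fun x => (h x).symm

theorem expSum_add_const (he : ∀ i, 0 ≤ e i) (hs : ProperExp e) (hq : constantCoeff q = 0) (c : ℕ) :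
    expSum (fun i => e i + c) q = q ^ c * expSum e q := by
  rw [expSum, expSum, ← (hs.summable hq).tsum_mul_left]
  refine tsum_congr fun i => ?_
  rw [Int.toNat_add (he i) c.cast_nonneg, Int.toNat_natCast, pow_add, mul_comm]

/-- The images of `i` and `j` partition the index type. With affine maps of ℤ or ℤ² for `i` and `j`,
this coset splitting is the mechanism behind all the theta identities. -/
theorem expSum_eq_add {α β : Type*} (he : ProperExp e) (hq : constantCoeff q = 0) {i : α → ι}
    {j : β → ι} (hi : i.Injective) (hj : j.Injective) (hij : ∀ a b, i a ≠ j b)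
    (h : ∀ x, (∃ a, i a = x) ∨ ∃ b, j b = x) :
    expSum e q = expSum (fun a => e (i a)) q + expSum (fun b => e (j b)) q := by
  have hc : IsCompl (Set.range i) (Set.range j) := by
    refine ⟨Set.disjoint_left.mpr ?_, codisjoint_iff.mpr (Set.eq_univ_of_forall fun x => h x)⟩
    rintro _ ⟨a, rfl⟩ ⟨b, hb⟩
    exact hij a b hb.symm
  have h1 : HasSum (fun x : Set.range i => q ^ (e x).toNat) (expSum (fun a => e (i a)) q) :=
    (hi.hasSum_range_iff (f := fun x => q ^ (e x).toNat)).mpr ((he.comp hi).summable hq).hasSum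
  have h2 : HasSum (fun x : Set.range j => q ^ (e x).toNat) (expSum (fun b => e (j b)) q) :=
    (hj.hasSum_range_iff (f := fun x => q ^ (e x).toNat)).mpr ((he.comp hj).summable hq).hasSum
  have h3 : HasSum (fun x => q ^ (e x).toNat) _ := HasSum.add_isCompl hc h1 h2
  exact h3.tsum_eq

theorem expSum_eq_add_add {α β γ : Type*} (he : ProperExp e) (hq : constantCoeff q = 0) {i : α → ι}
    {j : β → ι} {k : γ → ι} (hi : i.Injective) (hj : j.Injective) (hk : k.Injective)
    (hij : ∀ a b, i a ≠ j b) (hik : ∀ a b, i a ≠ k b) (hjk : ∀ a b, j a ≠ k b)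
    (h : ∀ x, (∃ a, i a = x) ∨ (∃ b, j b = x) ∨ ∃ c, k c = x) :
    expSum e q = expSum (fun a => e (i a)) q + expSum (fun b => e (j b)) q +
      expSum (fun b => e (k b)) q := by
  have hjk' : (Sum.elim j k).Injective := hj.sumElim hk hjk
  rw [expSum_eq_add he hq hi hjk' (fun a b => by cases b <;> simp [hij, hik])
    fun x => by simpa [Sum.exists] using h x, add_assoc]
  congr 1
  exact expSum_eq_add (he.comp hjk') hq Sum.inl_injective Sum.inr_injective
    (fun a b => by simp) fun x => by cases x <;> simp

end expSum

/-! ### Theta identities from sublattices of ℤ and ℤ² -/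

section theta

open PowerSeries

variable {q : ℂ⟦X⟧}

theorem two_mul_triangle (n : ℤ) : 2 * (n * (n + 1) / 2) = n * (n + 1) :=
  Int.mul_ediv_cancel' (Int.even_mul_succ_self n).two_dvd

theorem properExp_sq : ProperExp fun n : ℤ => n * n :=
  properExp_of_natAbs_le mul_self_nonneg fun n => by
    rcases abs_cases n with ⟨h, _⟩ | ⟨h, _⟩ <;> rw [h] <;> nlinarith

theorem properExp_triangle : ProperExp fun n : ℤ => n * (n + 1) / 2 := by
  have h0 : ∀ n : ℤ, 0 ≤ n * (n + 1) / 2 := fun n => by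
    have := two_mul_triangle n
    have := two_mul_toNat_mul_add_one n
    omega
  refine properExp_of_natAbs_le h0 fun n => ?_
  have h1 := two_mul_triangle n
  have h2 := h0 n
  generalize n * (n + 1) / 2 = t at *
  by_contra! h
  rcases abs_cases n with ⟨h', _⟩ | ⟨h', _⟩ <;> rw [h'] at h <;> nlinarith

/-- ℤ² is split by the parity of the coordinate sum. The even coset gives (x+y)² + (x-y)² = 2x² +
2y², the odd one (x+y+1)² + (x-y)² = 4T(x) + 4T(y) + 1, where T(n) = n(n+1)/2. -/
theorem thetaPhi_sq (hq : constantCoeff q = 0) :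
    thetaPhi q ^ 2 = thetaPhi (q ^ 2) ^ 2 + q * thetaPsi (q ^ 4) ^ 2 := by
  have hs := properExp_sq
  have ht := properExp_triangle
  have hs2 := hs.const_mul two_pos
  have ht4 := ht.const_mul (k := 4) (by decide)
  have e1 : thetaPhi q = expSum (fun n : ℤ => n * n) q := rfl
  have e2 : thetaPhi (q ^ 2) = _ := expSum_pow (e := fun n : ℤ => n * n) (q := q) 2
  have e3 : thetaPsi (q ^ 4) = _ := expSum_pow (e := fun n : ℤ => n * (n + 1) / 2) (q := q) 4
  rw [sq (thetaPhi q), sq (thetaPhi (q ^ 2)), sq (thetaPsi (q ^ 4)), e1, e2, e3, expSum_mul hs hs hq, expSum_mul hs2 hs2 hq, expSum_mul ht4 ht4 hq,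
    expSum_eq_add (hs.add hs) hq (i := fun x : ℤ × ℤ => (x.1 + x.2, x.1 - x.2))
      (j := fun x : ℤ × ℤ => (x.1 + x.2 + 1, x.1 - x.2))]
  · have h := expSum_add_const (ht4.add ht4).1 (ht4.add ht4) hq 1
    rw [pow_one] at h
    rw [← h]
    congr 2 <;> funext x <;> push_cast
    · ring
    · linear_combination (-2) * two_mul_triangle x.1 - 2 * two_mul_triangle x.2
  · rintro ⟨a, b⟩ ⟨c, d⟩ h
    simp only [Prod.mk.injEq] at *
    omega
  · rintro ⟨a, b⟩ ⟨c, d⟩ h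
    simp only [Prod.mk.injEq] at *
    omega
  · rintro ⟨a, b⟩ ⟨c, d⟩ h
    simp only [Prod.mk.injEq] at *
    omega
  · rintro ⟨a, b⟩
    rcases Int.even_or_odd' (a + b) with ⟨c, h | h⟩
    · exact Or.inl ⟨(c, c - b), by ext <;> simp; omega⟩
    · exact Or.inr ⟨(c, c - b), by ext <;> simp; omega⟩

/-- The form m² + 3n² has the parity of m + n, so the difference is twice the sum over the odd
coset. The ψ-product, split by parity in the same way, is twice that coset sum without its factor q.
-/
theorem thetaPhi_mul_sub (hq : constantCoeff q = 0) :
    thetaPhi q * thetaPhi (q ^ 3) - thetaPhi (-q) * thetaPhi (-q ^ 3) =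
      q * (thetaPsi (q ^ 2) * thetaPsi (q ^ 6)) := by
  have hs := properExp_sq
  have ht := properExp_triangle
  have hs3 := hs.const_mul three_pos
  have ht2 := ht.const_mul two_pos
  have ht6 := ht.const_mul (k := 6) (by decide)
  have key : ∀ r : ℂ⟦X⟧, constantCoeff r = 0 → thetaPhi r * thetaPhi (r ^ 3) =
      expSum (fun x : ℤ × ℤ => (x.1 + x.2) * (x.1 + x.2) + 3 * ((x.1 - x.2) * (x.1 - x.2))) r +
      expSum (fun x : ℤ × ℤ => (x.1 + x.2 + 1) * (x.1 + x.2 + 1) +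
        3 * ((x.1 - x.2) * (x.1 - x.2))) r := by
    intro r hr
    have e1 : thetaPhi r = expSum (fun n : ℤ => n * n) r := rfl
    have e2 : thetaPhi (r ^ 3) = _ := expSum_pow (e := fun n : ℤ => n * n) (q := r) 3
    rw [e1, e2, expSum_mul hs hs3 hr]
    refine expSum_eq_add (hs.add hs3) hr (i := fun x : ℤ × ℤ => (x.1 + x.2, x.1 - x.2))
      (j := fun x : ℤ × ℤ => (x.1 + x.2 + 1, x.1 - x.2)) ?_ ?_ ?_ ?_
    · rintro ⟨a, b⟩ ⟨c, d⟩ h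
      simp only [Prod.mk.injEq] at *
      omega
    · rintro ⟨a, b⟩ ⟨c, d⟩ h
      simp only [Prod.mk.injEq] at *
      omega
    · rintro ⟨a, b⟩ ⟨c, d⟩ h
      simp only [Prod.mk.injEq] at *
      omega
    · rintro ⟨a, b⟩
      rcases Int.even_or_odd' (a + b) with ⟨c, h | h⟩
      · exact Or.inl ⟨(c, c - b), by ext <;> simp; omega⟩
      · exact Or.inr ⟨(c, c - b), by ext <;> simp; omega⟩
  have hev : expSum (fun x : ℤ × ℤ => (x.1 + x.2) * (x.1 + x.2) +
      3 * ((x.1 - x.2) * (x.1 - x.2))) (-q) = expSum (fun x : ℤ × ℤ => (x.1 + x.2) * (x.1 + x.2) +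
      3 * ((x.1 - x.2) * (x.1 - x.2))) q := by
    refine tsum_congr fun x => Even.neg_pow ?_ q
    have h : (x.1 + x.2) * (x.1 + x.2) + 3 * ((x.1 - x.2) * (x.1 - x.2)) =
      2 * (2 * (x.1 * x.1) + 2 * (x.2 * x.2) - 2 * (x.1 * x.2)) := by ring
    beta_reduce
    rw [h, even_iff_two_dvd]
    omega
  have hod : expSum (fun x : ℤ × ℤ => (x.1 + x.2 + 1) * (x.1 + x.2 + 1) +
      3 * ((x.1 - x.2) * (x.1 - x.2))) (-q) = -expSum (fun x : ℤ × ℤ =>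
      (x.1 + x.2 + 1) * (x.1 + x.2 + 1) + 3 * ((x.1 - x.2) * (x.1 - x.2))) q := by
    rw [expSum, expSum, ← tsum_neg]
    refine tsum_congr fun x => Odd.neg_pow ?_ q
    have h : (x.1 + x.2 + 1) * (x.1 + x.2 + 1) + 3 * ((x.1 - x.2) * (x.1 - x.2)) =
      2 * (2 * (x.1 * x.1) + 2 * (x.2 * x.2) - 2 * (x.1 * x.2) + x.1 + x.2) + 1 := by ring
    have h0 : 0 ≤ (x.1 + x.2 + 1) * (x.1 + x.2 + 1) + 3 * ((x.1 - x.2) * (x.1 - x.2)) :=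
      add_nonneg (mul_self_nonneg _) (mul_nonneg (by norm_num) (mul_self_nonneg _))
    rw [h] at h0 ⊢
    generalize 2 * (x.1 * x.1) + 2 * (x.2 * x.2) - 2 * (x.1 * x.2) + x.1 + x.2 = y at *
    rw [Nat.odd_iff]
    omega
  have e3 : thetaPsi (q ^ 2) = _ := expSum_pow (e := fun n : ℤ => n * (n + 1) / 2) (q := q) 2
  have e4 : thetaPsi (q ^ 6) = _ := expSum_pow (e := fun n : ℤ => n * (n + 1) / 2) (q := q) 6
  -- The coset where the coordinates have equal parity. The other coset is its image under b ↦ -1 -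
  -- b, which preserves triangular numbers, so both contribute equally.
  have hi : (fun x : ℤ × ℤ => (2 * x.1 - x.2, x.2)).Injective := by
    rintro ⟨a, b⟩ ⟨c, d⟩ h
    simp only [Prod.mk.injEq] at *
    omega
  have h2 := expSum_eq_add (ht2.add ht6) hq (i := fun x : ℤ × ℤ => (2 * x.1 - x.2, x.2))
    (j := fun x : ℤ × ℤ => (2 * x.1 - x.2, -1 - x.2)) hi (by
      rintro ⟨a, b⟩ ⟨c, d⟩ h
      simp only [Prod.mk.injEq] at *
      omega) (by
      rintro ⟨a, b⟩ ⟨c, d⟩ h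
      simp only [Prod.mk.injEq] at *
      omega) (by
      rintro ⟨a, b⟩
      rcases Int.even_or_odd' (a + b) with ⟨c, h | h⟩
      · exact Or.inl ⟨(c, b), by ext <;> simp; omega⟩
      · exact Or.inr ⟨(c - b, -1 - b), by ext <;> simp; omega⟩)
  have hp := (ht2.add ht6).comp hi
  have h3 := expSum_add_const hp.1 hp hq 1
  rw [pow_one] at h3
  rw [← Odd.neg_pow (by decide : Odd 3), key q hq, key (-q) (by simp [hq]), hev, hod, e3, e4,
    expSum_mul ht2 ht6 hq, h2, mul_add]
  have e5 : expSum (fun x : ℤ × ℤ => ((2 : ℕ) : ℤ) * ((2 * x.1 - x.2) * (2 * x.1 - x.2 + 1) / 2) +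
      ((6 : ℕ) : ℤ) * ((-1 - x.2) * (-1 - x.2 + 1) / 2)) q = expSum (fun x : ℤ × ℤ =>
      ((2 : ℕ) : ℤ) * ((2 * x.1 - x.2) * (2 * x.1 - x.2 + 1) / 2) +
      ((6 : ℕ) : ℤ) * (x.2 * (x.2 + 1) / 2)) q := by
    congr 1
    funext x
    rw [show (-1 - x.2) * (-1 - x.2 + 1) = x.2 * (x.2 + 1) by ring]
  have e6 : expSum (fun x : ℤ × ℤ => (x.1 + x.2 + 1) * (x.1 + x.2 + 1) +
      3 * ((x.1 - x.2) * (x.1 - x.2))) q = q * expSum (fun x : ℤ × ℤ =>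
      ((2 : ℕ) : ℤ) * ((2 * x.1 - x.2) * (2 * x.1 - x.2 + 1) / 2) +
      ((6 : ℕ) : ℤ) * (x.2 * (x.2 + 1) / 2)) q := by
    refine Eq.trans ?_ h3
    congr 1
    funext x
    simp only [Function.comp_apply]
    push_cast
    linear_combination (-1) * two_mul_triangle (2 * x.1 - x.2) - 3 * two_mul_triangle x.2
  rw [e5, ← e6]
  ring

/-- T(a) + 3T(b), with T(n) = n(n+1)/2, is first halved using b ↦ -1 - b, leaving a and b of equal
parity. A further split then diagonalizes the form. -/
theorem thetaPsi_mul_thetaPsi (hq : constantCoeff q = 0) :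
    thetaPsi q * thetaPsi (q ^ 3) =
      2 * (thetaPsi (q ^ 4) * thetaPhi (q ^ 6)) + 2 * q * (thetaPhi (q ^ 2) * thetaPsi (q ^ 12)) := by
  have hs := properExp_sq
  have ht := properExp_triangle
  have hs2 := hs.const_mul two_pos
  have hs6 := hs.const_mul (k := 6) (by decide)
  have ht3 := ht.const_mul three_pos
  have ht4 := ht.const_mul (k := 4) (by decide)
  have ht12 := ht.const_mul (k := 12) (by decide)
  have e1 : thetaPsi q = expSum (fun n : ℤ => n * (n + 1) / 2) q := rfl
  have e2 : thetaPsi (q ^ 3) = _ := expSum_pow (e := fun n : ℤ => n * (n + 1) / 2) (q := q) 3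
  have e3 : thetaPsi (q ^ 4) = _ := expSum_pow (e := fun n : ℤ => n * (n + 1) / 2) (q := q) 4
  have e4 : thetaPsi (q ^ 12) = _ := expSum_pow (e := fun n : ℤ => n * (n + 1) / 2) (q := q) 12
  have e5 : thetaPhi (q ^ 2) = _ := expSum_pow (e := fun n : ℤ => n * n) (q := q) 2
  have e6 : thetaPhi (q ^ 6) = _ := expSum_pow (e := fun n : ℤ => n * n) (q := q) 6
  have hi : (fun x : ℤ × ℤ => (x.1 + 2 * x.2, x.1)).Injective := by
    rintro ⟨a, b⟩ ⟨c, d⟩ h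
    simp only [Prod.mk.injEq] at *
    omega
  have h1 := expSum_eq_add (ht.add ht3) hq (i := fun x : ℤ × ℤ => (x.1 + 2 * x.2, x.1))
    (j := fun x : ℤ × ℤ => (x.1 + 2 * x.2, -1 - x.1)) hi (by
      rintro ⟨a, b⟩ ⟨c, d⟩ h
      simp only [Prod.mk.injEq] at *
      omega) (by
      rintro ⟨a, b⟩ ⟨c, d⟩ h
      simp only [Prod.mk.injEq] at *
      omega) (by
      rintro ⟨a, b⟩
      rcases Int.even_or_odd' (a + b) with ⟨c, h | h⟩
      · exact Or.inl ⟨(b, c - b), by ext <;> simp; omega⟩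
      · exact Or.inr ⟨(-1 - b, c + 1), by ext <;> simp; omega⟩)
  -- Composed with the first substitution, these maps give (a, b) = (x+3y, x-y) and (x+3y+1, x-y-1).
  -- The cross terms of T(a) + 3T(b) cancel, leaving 4T(x) + 6y² and 2x² + 12T(y) + 1.
  have h2 := expSum_eq_add ((ht.add ht3).comp hi) hq
    (i := fun x : ℤ × ℤ => (x.1 - x.2, 2 * x.2))
    (j := fun x : ℤ × ℤ => (x.1 - x.2 - 1, 2 * x.2 + 1)) (by
      rintro ⟨a, b⟩ ⟨c, d⟩ h
      simp only [Prod.mk.injEq] at *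
      omega) (by
      rintro ⟨a, b⟩ ⟨c, d⟩ h
      simp only [Prod.mk.injEq] at *
      omega) (by
      rintro ⟨a, b⟩ ⟨c, d⟩ h
      simp only [Prod.mk.injEq] at *
      omega) (by
      rintro ⟨a, b⟩
      rcases Int.even_or_odd' b with ⟨c, h | h⟩
      · exact Or.inl ⟨(a + c, c), by ext <;> simp; omega⟩
      · exact Or.inr ⟨(a + c + 1, c), by ext <;> simp <;> omega⟩)
  have h3 := expSum_add_const (hs2.add ht12).1 (hs2.add ht12) hq 1
  rw [pow_one] at h3
  have e7 : expSum (fun x : ℤ × ℤ => (x.1 + 2 * x.2) * (x.1 + 2 * x.2 + 1) / 2 +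
      ((3 : ℕ) : ℤ) * ((-1 - x.1) * (-1 - x.1 + 1) / 2)) q =
      expSum ((fun x : ℤ × ℤ => x.1 * (x.1 + 1) / 2 + ((3 : ℕ) : ℤ) * (x.2 * (x.2 + 1) / 2)) ∘
        fun x : ℤ × ℤ => (x.1 + 2 * x.2, x.1)) q := by
    congr 1
    funext x
    simp only [Function.comp_apply]
    rw [show (-1 - x.1) * (-1 - x.1 + 1) = x.1 * (x.1 + 1) by ring]
  rw [e1, e2, e3, e4, e5, e6, expSum_mul ht ht3 hq, expSum_mul ht4 hs6 hq, expSum_mul hs2 ht12 hq,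
    h1, e7, mul_assoc 2 q, ← h3, ← mul_add]
  refine (two_mul _).symm.trans ?_
  congr 1
  refine h2.trans ?_
  congr 2 <;> funext x <;> simp only [Function.comp_apply]
  · have k1 := two_mul_triangle (x.1 - x.2 + 2 * (2 * x.2))
    have k2 := two_mul_triangle (x.1 - x.2)
    have k3 := two_mul_triangle x.1
    refine mul_left_cancel₀ (two_ne_zero (α := ℤ)) ?_
    push_cast
    linear_combination k1 + 3 * k2 - 4 * k3
  · have k1 := two_mul_triangle (x.1 - x.2 - 1 + 2 * (2 * x.2 + 1))
    have k2 := two_mul_triangle (x.1 - x.2 - 1)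
    have k3 := two_mul_triangle x.2
    refine mul_left_cancel₀ (two_ne_zero (α := ℤ)) ?_
    push_cast
    linear_combination k1 + 3 * k2 - 12 * k3

/-- Splitting n modulo 3, the classes 0 and 2 are exchanged by n ↦ -1 - n and give equal sums,
whereas n = 3m + 1 gives the exponent 9m(m+1)/2 + 1. -/
theorem thetaPsi_eq_add (hq : constantCoeff q = 0) :
    thetaPsi q = 2 * thetaA (q ^ 3) + q * thetaPsi (q ^ 9) := by
  have ht := properExp_triangle
  have ht9 := ht.const_mul (k := 9) (by decide)
  have e1 : thetaPsi q = expSum (fun n : ℤ => n * (n + 1) / 2) q := rfl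
  have e2 : thetaPsi (q ^ 9) = _ := expSum_pow (e := fun n : ℤ => n * (n + 1) / 2) (q := q) 9
  have e3 : thetaA (q ^ 3) = _ := expSum_pow (e := fun n : ℤ => n * (3 * n + 1) / 2) (q := q) 3
  have h := expSum_eq_add_add ht hq (i := fun m : ℤ => 3 * m) (j := fun m : ℤ => -1 - 3 * m)
    (k := fun m : ℤ => 3 * m + 1) (fun a b h => by simp only at h; omega)
    (fun a b h => by simp only at h; omega) (fun a b h => by simp only at h; omega)
    (fun a b h => by omega) (fun a b h => by omega) (fun a b h => by omega) fun n => by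
      have : n % 3 = 0 ∨ n % 3 = 1 ∨ n % 3 = 2 := by omega
      rcases this with h | h | h
      · exact Or.inl ⟨n / 3, by omega⟩
      · exact Or.inr (Or.inr ⟨n / 3, by omega⟩)
      · exact Or.inr (Or.inl ⟨-n / 3, by omega⟩)
  have h3 := expSum_add_const ht9.1 ht9 hq 1
  rw [pow_one] at h3
  rw [e1, e2, e3, h, ← h3, two_mul]
  have hA : ∀ m : ℤ, 3 * m * (3 * m + 1) / 2 = ((3 : ℕ) : ℤ) * (m * (3 * m + 1) / 2) := fun m => by
    have := two_mul_triangle (3 * m)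
    rw [show 3 * m * (3 * m + 1) = 3 * (m * (3 * m + 1)) by ring] at *
    push_cast
    omega
  congr 3 <;> funext m
  · exact hA m
  · rw [← hA m]
    congr 1
    ring
  · have k1 := two_mul_triangle (3 * m + 1)
    have k2 := two_mul_triangle m
    refine mul_left_cancel₀ (two_ne_zero (α := ℤ)) ?_
    push_cast
    linear_combination k1 - 9 * k2

/-- The classes 1 and -1 modulo 3 are exchanged by n ↦ -n, and (3m+1)² = 3(3m² + 2m) + 1. -/
theorem thetaPhi_eq_add (hq : constantCoeff q = 0) :
    thetaPhi q = thetaPhi (q ^ 9) + 2 * q * thetaOmega (q ^ 3) := by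
  have hs := properExp_sq
  have ho : ProperExp fun n : ℤ => 3 * (n * n) + 2 * n := by
    refine properExp_of_natAbs_le (fun n => ?_) fun n => ?_
    · rcases le_or_gt 0 n with h | h <;> nlinarith
    · rcases abs_cases n with ⟨h, _⟩ | ⟨h, _⟩ <;> rw [h] <;> nlinarith
  have ho3 := ho.const_mul three_pos
  have e1 : thetaPhi q = expSum (fun n : ℤ => n * n) q := rfl
  have e2 : thetaPhi (q ^ 9) = _ := expSum_pow (e := fun n : ℤ => n * n) (q := q) 9
  have e3 : thetaOmega (q ^ 3) = _ := expSum_pow (e := fun n : ℤ => 3 * (n * n) + 2 * n) (q := q) 3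
  have h := expSum_eq_add_add hs hq (i := fun m : ℤ => 3 * m) (j := fun m : ℤ => -1 - 3 * m)
    (k := fun m : ℤ => 3 * m + 1) (fun a b h => by simp only at h; omega)
    (fun a b h => by simp only at h; omega) (fun a b h => by simp only at h; omega)
    (fun a b h => by omega) (fun a b h => by omega) (fun a b h => by omega) fun n => by
      have : n % 3 = 0 ∨ n % 3 = 1 ∨ n % 3 = 2 := by omega
      rcases this with h | h | h
      · exact Or.inl ⟨n / 3, by omega⟩
      · exact Or.inr (Or.inr ⟨n / 3, by omega⟩)
      · exact Or.inr (Or.inl ⟨-n / 3, by omega⟩)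
  have h3 := expSum_add_const ho3.1 ho3 hq 1
  rw [pow_one] at h3
  rw [e1, e2, e3, h, mul_assoc, ← h3, two_mul, add_assoc]
  congr 3 <;> funext m <;> push_cast <;> ring

end theta

/-! ### Dissections of Euler quotients, in the fraction field -/

section dissections

open PowerSeries

variable {q : ℂ⟦X⟧}

local notation "ι" => algebraMap ℂ⟦X⟧ (FractionRing ℂ⟦X⟧)

instance : CharZero (FractionRing ℂ⟦X⟧) :=
  algebraRat.charZero _

theorem algebraMap_euler_ne_zero (hq : constantCoeff q = 0) : ι (euler q) ≠ 0 := fun h =>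
  euler_ne_zero hq ((map_eq_zero_iff _ (IsFractionRing.injective _ _)).mp h)

theorem algebraMap_thetaPhi_neg (hq : constantCoeff q = 0) (hq0 : q ≠ 0) :
    ι (thetaPhi (-q)) = ι (euler q) ^ 2 / ι (euler (q ^ 2)) := by
  rw [eq_div_iff (algebraMap_euler_ne_zero (by simp [hq])), ← map_mul, ← map_pow,
    thetaPhi_neg_mul hq hq0]

theorem algebraMap_thetaPhi (hq : constantCoeff q = 0) (hq0 : q ≠ 0) :
    ι (thetaPhi q) = ι (euler (-q)) ^ 2 / ι (euler (q ^ 2)) := by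
  have h := algebraMap_thetaPhi_neg (q := -q) (by simp [hq]) (by simpa using hq0)
  rwa [neg_neg, neg_sq] at h

theorem algebraMap_thetaPsi (hq : constantCoeff q = 0) (hq0 : q ≠ 0) :
    ι (thetaPsi q) = 2 * ι (euler (q ^ 2)) ^ 2 / ι (euler q) := by
  rw [eq_div_iff (algebraMap_euler_ne_zero hq), ← map_mul, ← map_pow, thetaPsi_mul hq hq0, map_mul,
    map_ofNat]

theorem algebraMap_thetaA (hq : constantCoeff q = 0) (hq0 : q ≠ 0) :
    ι (thetaA q) = ι (euler (q ^ 2)) * ι (euler (q ^ 3)) ^ 2 /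
      (ι (euler q) * ι (euler (q ^ 6))) := by
  have h := algebraMap_euler_ne_zero hq
  have h6 := algebraMap_euler_ne_zero (q := q ^ 6) (by simp [hq])
  rw [eq_div_iff (mul_ne_zero h h6), ← map_mul, ← map_mul, thetaA_mul hq hq0, map_mul, map_pow]

theorem algebraMap_thetaOmega_neg (hq : constantCoeff q = 0) (hq0 : q ≠ 0) :
    ι (thetaOmega (-q)) = ι (euler q) * ι (euler (q ^ 6)) ^ 2 /
      (ι (euler (q ^ 2)) * ι (euler (q ^ 3))) := by
  have h2 := algebraMap_euler_ne_zero (q := q ^ 2) (by simp [hq])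
  have h3 := algebraMap_euler_ne_zero (q := q ^ 3) (by simp [hq])
  rw [eq_div_iff (mul_ne_zero h2 h3), ← map_mul, ← map_mul, thetaOmega_neg_mul hq hq0, map_mul,
    map_pow]

theorem algebraMap_euler_neg (hq : constantCoeff q = 0) :
    ι (euler (-q)) = ι (euler (q ^ 2)) ^ 3 / (ι (euler q) * ι (euler (q ^ 4))) := by
  have h := algebraMap_euler_ne_zero hq
  have h4 := algebraMap_euler_ne_zero (q := q ^ 4) (by simp [hq])
  rw [eq_div_iff (mul_ne_zero h h4), ← map_mul, ← map_mul, ← map_pow, ← euler_neg_mul hq, mul_assoc]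

/-- The 3-dissection of `ψ`. -/
theorem euler_psi_three_dissection (hq : constantCoeff q = 0) (hq0 : q ≠ 0) :
    ι (euler (q ^ 2)) ^ 2 / ι (euler q) =
      ι (euler (q ^ 6)) * ι (euler (q ^ 9)) ^ 2 / (ι (euler (q ^ 18)) * ι (euler (q ^ 3))) +
        ι q * ι (euler (q ^ 18)) ^ 2 / ι (euler (q ^ 9)) := by
  have h := congrArg ι (thetaPsi_eq_add hq)
  rw [map_add, map_mul, map_mul, map_ofNat, algebraMap_thetaPsi hq hq0,
    algebraMap_thetaPsi (q := q ^ 9) (by simp [hq]) (pow_ne_zero _ hq0),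
    algebraMap_thetaA (q := q ^ 3) (by simp [hq]) (pow_ne_zero _ hq0)] at h
  simp only [← pow_mul] at h
  norm_num at h
  refine mul_left_cancel₀ (two_ne_zero (α := FractionRing ℂ⟦X⟧)) ?_
  linear_combination h

/-- The odd part of `f₃³ / f₁`. -/
theorem euler_cube_div_sub (hq : constantCoeff q = 0) (hq0 : q ≠ 0) :
    ι (euler (q ^ 3)) ^ 3 / ι (euler q) - ι (euler (-q ^ 3)) ^ 3 / ι (euler (-q)) =
      2 * ι q * ι (euler (q ^ 12)) ^ 3 / ι (euler (q ^ 4)) := by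
  have hk : ∀ k ≠ 0, constantCoeff (q ^ k) = 0 := fun k hk => by simp [hq, hk]
  have ne : ∀ k ≠ 0, ι (euler (q ^ k)) ≠ 0 := fun k h => algebraMap_euler_ne_zero (hk k h)
  have t1 := congrArg ι (thetaPhi_sq (q := -q ^ 3) (by simp [hq]))
  have t1' := congrArg ι (thetaPhi_sq (q := q ^ 3) (by simp [hq]))
  have t2 := congrArg ι (thetaPsi_mul_thetaPsi hq)
  have t2' := congrArg ι (thetaPsi_mul_thetaPsi (q := -q) (by simp [hq]))
  have t3 := congrArg ι (thetaPhi_mul_sub (hk 2 (by decide)))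
  have p1 := algebraMap_thetaPhi_neg (hk 3 (by decide)) (pow_ne_zero _ hq0)
  have p2 := algebraMap_thetaPhi (hk 3 (by decide)) (pow_ne_zero _ hq0)
  have p3 := algebraMap_thetaPsi hq hq0
  have p4 := algebraMap_thetaPsi (q := -q) (by simp [hq]) (by simpa using hq0)
  have p5 := algebraMap_thetaPsi (hk 3 (by decide)) (pow_ne_zero _ hq0)
  have p6 := algebraMap_thetaPsi (q := -q ^ 3) (by simp [hq]) (by simpa using hq0)
  have p7 := algebraMap_thetaPhi_neg (hk 2 (by decide)) (pow_ne_zero _ hq0)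
  have p8 := algebraMap_thetaPhi_neg (hk 6 (by decide)) (pow_ne_zero _ hq0)
  have p9 := algebraMap_thetaPhi (hk 6 (by decide)) (pow_ne_zero _ hq0)
  have p10 := algebraMap_euler_neg (hk 6 (by decide))
  have p11 := algebraMap_thetaPsi (hk 12 (by decide)) (pow_ne_zero _ hq0)
  have ev : ∀ k, Even k → (-q) ^ k = q ^ k := fun k hk => hk.neg_pow q
  have od : (-q) ^ 3 = -q ^ 3 := Odd.neg_pow (by decide) q
  rw [ev 2 (by decide), ev 4 (by decide), ev 6 (by decide), ev 12 (by decide), od] at t2'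
  rw [ev 2 (by decide)] at p4
  simp only [neg_sq, Even.neg_pow (show Even 4 by decide), ← pow_mul, map_add, map_sub, map_mul,
    map_neg, map_ofNat, map_pow] at *
  norm_num at t1 t1' t2 t2' t3 p1 p2 p5 p6 p7 p8 p9 p10 p11
  have n1 := algebraMap_euler_ne_zero hq
  have n1' := algebraMap_euler_ne_zero (q := -q) (by simp [hq])
  have n3' := algebraMap_euler_ne_zero (q := -q ^ 3) (by simp [hq])
  have n2 := ne 2 (by decide)
  have n3 := ne 3 (by decide)
  have n4 := ne 4 (by decide)
  have n6 := ne 6 (by decide)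
  have n12 := ne 12 (by decide)
  have n24 := ne 24 (by decide)
  -- f₂² f₃³/f₁ = φ(-q³)² ψ(q) ψ(q³); the 4 appears because `thetaPsi` is 2ψ.
  have h1 : 4 * ι (euler (q ^ 2)) ^ 2 * (ι (euler (q ^ 3)) ^ 3 / ι (euler q)) =
      ι (thetaPhi (-q ^ 3)) ^ 2 * (ι (thetaPsi q) * ι (thetaPsi (q ^ 3))) := by
    rw [p1, p3, p5]
    field_simp
    norm_num
  have h2 : 4 * ι (euler (q ^ 2)) ^ 2 * (ι (euler (-q ^ 3)) ^ 3 / ι (euler (-q))) =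
      ι (thetaPhi (q ^ 3)) ^ 2 * (ι (thetaPsi (-q)) * ι (thetaPsi (-q ^ 3))) := by
    rw [p2, p4, p6]
    field_simp
    norm_num
  have h3 : ι (thetaPsi (q ^ 12)) * ι (thetaPhi (q ^ 6)) * ι (thetaPhi (-q ^ 6)) =
      2 * ι (euler (q ^ 12)) ^ 3 := by
    rw [p11, p9, p8, p10]
    field_simp
  refine mul_left_cancel₀ (mul_ne_zero (OfNat.ofNat_ne_zero 4) (pow_ne_zero 2 n2)) ?_
  rw [mul_sub, h1, h2, t1, t1', t2, t2']
  have h4 : ι (thetaPhi (-q ^ 2)) * (2 * ι (euler (q ^ 12)) ^ 3) =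
      2 * ι (euler (q ^ 12)) ^ 3 * ι (euler (q ^ 2)) ^ 2 / ι (euler (q ^ 4)) := by
    rw [p7]
    ring
  -- The odd part contains the bracket φ(q²)φ(q⁶) - 4q²ψ(q⁴)ψ(q¹²), which `t3` turns into
  -- φ(-q²)φ(-q⁶).
  linear_combination (4 * ι q * ι (thetaPsi (q ^ 12)) * ι (thetaPhi (q ^ 6))) * t3 +
    4 * ι q * ι (thetaPhi (-q ^ 2)) * h3 + 4 * ι q * h4

theorem constantCoeff_thetaPsi (hq : constantCoeff q = 0) (hq0 : q ≠ 0) :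
    constantCoeff (thetaPsi q) = 2 := by
  have h := congrArg constantCoeff (thetaPsi_mul hq hq0)
  simpa [constantCoeff_euler, hq, map_ofNat] using h

theorem constantCoeff_thetaPhi (hq : constantCoeff q = 0) (hq0 : q ≠ 0) :
    constantCoeff (thetaPhi q) = 1 := by
  have h := congrArg constantCoeff (thetaPhi_neg_mul (q := -q) (by simp [hq]) (by simpa using hq0))
  simpa [constantCoeff_euler, hq, map_ofNat] using h

/-- The odd part of `f₃ / f₁³`, given the relation of level 6 between `f₁`, `f₂`, `f₃`, `f₆`. -/
theorem euler_div_cube_sub (hq : constantCoeff q = 0) (hq0 : q ≠ 0)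
    (H : euler (q ^ 4) ^ 9 * euler (q ^ 6) ^ 4 - euler (q ^ 2) ^ 9 * euler (q ^ 6) *
      euler (q ^ 12) ^ 3 = 9 * q ^ 2 * euler (q ^ 2) ^ 4 * euler (q ^ 4) * euler (q ^ 12) ^ 8) :
    ι (euler (q ^ 3)) / ι (euler q) ^ 3 - ι (euler (-q ^ 3)) / ι (euler (-q)) ^ 3 =
      6 * ι q * ι (euler (q ^ 4)) ^ 2 * ι (euler (q ^ 6)) * ι (euler (q ^ 12)) ^ 2 /
        ι (euler (q ^ 2)) ^ 7 := by
  have hk : ∀ k ≠ 0, constantCoeff (q ^ k) = 0 := fun k hk => by simp [hq, hk]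
  have ne : ∀ k ≠ 0, ι (euler (q ^ k)) ≠ 0 := fun k h => algebraMap_euler_ne_zero (hk k h)
  have c4 := constantCoeff_thetaPsi (hk 4 (by decide)) (pow_ne_zero _ hq0)
  have c12 := constantCoeff_thetaPsi (hk 12 (by decide)) (pow_ne_zero _ hq0)
  have c2 := constantCoeff_thetaPhi (hk 2 (by decide)) (pow_ne_zero _ hq0)
  have c6 := constantCoeff_thetaPhi (hk 6 (by decide)) (pow_ne_zero _ hq0)
  have d2 := constantCoeff_euler (hk 2 (by decide))
  have d4 := constantCoeff_euler (hk 4 (by decide))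
  have d12 := constantCoeff_euler (hk 12 (by decide))
  have t1 := congrArg ι (thetaPhi_sq (q := -q) (by simp [hq]))
  have t1' := congrArg ι (thetaPhi_sq hq)
  have t2 := congrArg ι (thetaPsi_mul_thetaPsi hq)
  have t2' := congrArg ι (thetaPsi_mul_thetaPsi (q := -q) (by simp [hq]))
  have t3 := congrArg ι (thetaPhi_mul_sub (hk 2 (by decide)))
  have p1 := algebraMap_thetaPhi_neg hq hq0
  have p2 := algebraMap_thetaPhi hq hq0
  have p3 := algebraMap_thetaPsi hq hq0
  have p4 := algebraMap_thetaPsi (q := -q) (by simp [hq]) (by simpa using hq0)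
  have p5 := algebraMap_thetaPsi (hk 3 (by decide)) (pow_ne_zero _ hq0)
  have p6 := algebraMap_thetaPsi (q := -q ^ 3) (by simp [hq]) (by simpa using hq0)
  have p7 := algebraMap_thetaPhi_neg (hk 2 (by decide)) (pow_ne_zero _ hq0)
  have p8 := algebraMap_thetaPhi_neg (hk 6 (by decide)) (pow_ne_zero _ hq0)
  have p9 := algebraMap_thetaPhi (hk 2 (by decide)) (pow_ne_zero _ hq0)
  have p10 := algebraMap_euler_neg (hk 2 (by decide))
  have p11 := algebraMap_thetaPsi (hk 4 (by decide)) (pow_ne_zero _ hq0)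
  have p12 := algebraMap_euler_neg hq
  have p13 := algebraMap_euler_neg (hk 3 (by decide))
  have H' := congrArg ι H
  have n1 := algebraMap_euler_ne_zero hq
  have n1' := algebraMap_euler_ne_zero (q := -q) (by simp [hq])
  have n3' := algebraMap_euler_ne_zero (q := -q ^ 3) (by simp [hq])
  have nq : ι q ≠ 0 := fun h => hq0 ((map_eq_zero_iff _ (IsFractionRing.injective _ _)).mp h)
  have ev : ∀ k, Even k → (-q) ^ k = q ^ k := fun k hk => hk.neg_pow q
  have od : (-q) ^ 3 = -q ^ 3 := Odd.neg_pow (by decide) q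
  rw [ev 2 (by decide), ev 4 (by decide), ev 6 (by decide), ev 12 (by decide), od] at t2'
  rw [ev 2 (by decide)] at p4
  rw [ev 2 (by decide), ev 4 (by decide)] at t1
  simp only [neg_sq, ← pow_mul, map_add, map_sub, map_mul,
    map_neg, map_ofNat, map_pow] at t1 t1' t2 t2' t3 p5 p6 p7 p8 p9 p10 p11 p13 H'
  norm_num at t1 t1' t2 t2' t3 p5 p6 p7 p8 p9 p10 p11 p13 H'
  have n2 := ne 2 (by decide)
  have n3 := ne 3 (by decide)
  have n4 := ne 4 (by decide)
  have n6 := ne 6 (by decide)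
  have n8 := ne 8 (by decide)
  have n12 := ne 12 (by decide)
  -- Up to the factor q/(2f₆²), `D` is the odd part of f₁³/f₃ as delivered by the theta identities.
  -- No product form of it is known at this point.
  set D : ℂ⟦X⟧ := thetaPhi (q ^ 2) ^ 3 * thetaPsi (q ^ 12) - thetaPsi (q ^ 4) ^ 3 * thetaPhi (q ^ 6)
    with hD
  have hιD : ι D = ι (thetaPhi (q ^ 2)) ^ 3 * ι (thetaPsi (q ^ 12)) -
      ι (thetaPsi (q ^ 4)) ^ 3 * ι (thetaPhi (q ^ 6)) := by
    simp only [hD, map_sub, map_mul, map_pow]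
  have h1 : 4 * ι (euler (q ^ 6)) ^ 2 * (ι (euler q) ^ 3 / ι (euler (q ^ 3))) =
      ι (thetaPhi (-q)) ^ 2 * (ι (thetaPsi q) * ι (thetaPsi (q ^ 3))) := by
    rw [p1, p3, p5]
    field_simp
    norm_num
  have h2 : 4 * ι (euler (q ^ 6)) ^ 2 * (ι (euler (-q)) ^ 3 / ι (euler (-q ^ 3))) =
      ι (thetaPhi q) ^ 2 * (ι (thetaPsi (-q)) * ι (thetaPsi (-q ^ 3))) := by
    rw [p2, p4, p6]
    field_simp
    norm_num
  have h3 : ι (thetaPsi (q ^ 4)) * ι (thetaPhi (q ^ 2)) * ι (thetaPhi (-q ^ 2)) =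
      2 * ι (euler (q ^ 4)) ^ 3 := by
    rw [p11, p9, p7, p10]
    field_simp
  have h4 : ι (thetaPsi (q ^ 4)) * ι (thetaPhi (q ^ 2)) * (ι (thetaPhi (-q ^ 2)) *
      ι (thetaPhi (-q ^ 6))) = 2 * ι (euler (q ^ 4)) ^ 3 * ι (euler (q ^ 6)) ^ 2 /
        ι (euler (q ^ 12)) := by
    rw [← mul_assoc, h3, p8]
    ring
  -- Here f₆² f₁³/f₃ = φ(-q)² ψ(q) ψ(q³), and `t3` collapses its even part to a single product.
  have hC : ι (euler q) ^ 3 / ι (euler (q ^ 3)) = ι (euler (q ^ 4)) ^ 3 / ι (euler (q ^ 12)) +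
      ι q * ι D / (2 * ι (euler (q ^ 6)) ^ 2) := by
    refine mul_left_cancel₀ (mul_ne_zero (OfNat.ofNat_ne_zero 4) (pow_ne_zero 2 n6)) ?_
    rw [h1, t1, t2, hιD]
    field_simp
    field_simp at h4
    linear_combination 4 * h4 + 4 * ι (euler (q ^ 12)) * ι (thetaPsi (q ^ 4)) *
      ι (thetaPhi (q ^ 2)) * t3
  have hC' : ι (euler (-q)) ^ 3 / ι (euler (-q ^ 3)) = ι (euler (q ^ 4)) ^ 3 / ι (euler (q ^ 12)) -
      ι q * ι D / (2 * ι (euler (q ^ 6)) ^ 2) := by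
    refine mul_left_cancel₀ (mul_ne_zero (OfNat.ofNat_ne_zero 4) (pow_ne_zero 2 n6)) ?_
    rw [h2, t1', t2', hιD]
    field_simp
    field_simp at h4
    linear_combination 4 * h4 + 4 * ι (euler (q ^ 12)) * ι (thetaPsi (q ^ 4)) *
      ι (thetaPhi (q ^ 2)) * t3
  have hCC : ι (euler q) ^ 3 / ι (euler (q ^ 3)) * (ι (euler (-q)) ^ 3 / ι (euler (-q ^ 3))) =
      ι (euler (q ^ 2)) ^ 9 * ι (euler (q ^ 12)) / (ι (euler (q ^ 4)) ^ 3 *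
        ι (euler (q ^ 6)) ^ 3) := by
    rw [p12, p13]
    field_simp
  -- (Odd part)² = (even part)² - F(q)F(-q) for F = f₁³/f₃, and `H` says that the right side is a
  -- square.
  have hsq : (D * euler (q ^ 4)) ^ 2 = (6 * euler (q ^ 2) ^ 2 * euler (q ^ 12) ^ 3) ^ 2 := by
    apply IsFractionRing.injective ℂ⟦X⟧ (FractionRing ℂ⟦X⟧)
    simp only [map_mul, map_pow, map_ofNat]
    have h5 : ι q ^ 2 * ι D ^ 2 / (4 * ι (euler (q ^ 6)) ^ 4) =
        (ι (euler (q ^ 4)) ^ 3 / ι (euler (q ^ 12))) ^ 2 - ι (euler (q ^ 2)) ^ 9 *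
          ι (euler (q ^ 12)) / (ι (euler (q ^ 4)) ^ 3 * ι (euler (q ^ 6)) ^ 3) := by
      rw [← hCC, hC, hC']
      ring
    have h7 : (ι (euler (q ^ 4)) ^ 3 / ι (euler (q ^ 12))) ^ 2 - ι (euler (q ^ 2)) ^ 9 *
        ι (euler (q ^ 12)) / (ι (euler (q ^ 4)) ^ 3 * ι (euler (q ^ 6)) ^ 3) =
        ι q ^ 2 * (9 * ι (euler (q ^ 2)) ^ 4 * ι (euler (q ^ 12)) ^ 6 /
          (ι (euler (q ^ 4)) ^ 2 * ι (euler (q ^ 6)) ^ 4)) := by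
      refine mul_left_cancel₀ (mul_ne_zero (mul_ne_zero (pow_ne_zero 3 n4) (pow_ne_zero 4 n6))
        (pow_ne_zero 2 n12)) ?_
      refine Eq.trans ?_ (H'.trans ?_) <;> field_simp
    rw [h7, mul_div_assoc] at h5
    have h8 := mul_left_cancel₀ (pow_ne_zero 2 nq) h5
    rw [div_eq_iff (mul_ne_zero (OfNat.ofNat_ne_zero 4) (pow_ne_zero 4 n6))] at h8
    rw [mul_pow, h8]
    field_simp
    norm_num
  -- The constant term of `D` is 1³·2 - 2³·1 = -6, which excludes the positive root.
  have hsign : D * euler (q ^ 4) = -(6 * euler (q ^ 2) ^ 2 * euler (q ^ 12) ^ 3) := by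
    refine (sq_eq_sq_iff_eq_or_eq_neg.mp hsq).resolve_left fun h => ?_
    have := congrArg constantCoeff h
    simp only [hD, map_mul, map_sub, map_pow, map_ofNat, c2, c4, c6, c12, d2, d4, d12] at this
    norm_num at this
  have hιD' : ι D = -(6 * ι (euler (q ^ 2)) ^ 2 * ι (euler (q ^ 12)) ^ 3) / ι (euler (q ^ 4)) := by
    rw [eq_div_iff n4, ← map_mul, hsign]
    simp only [map_neg, map_mul, map_pow, map_ofNat]
  -- 1/F(q) - 1/F(-q) = (F(-q) - F(q))/(F(q)F(-q)), so only the odd part and the norm of F are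
  -- needed.
  have h6 : ι (euler (q ^ 3)) / ι (euler q) ^ 3 - ι (euler (-q ^ 3)) / ι (euler (-q)) ^ 3 =
      (ι (euler (-q)) ^ 3 / ι (euler (-q ^ 3)) - ι (euler q) ^ 3 / ι (euler (q ^ 3))) /
      (ι (euler q) ^ 3 / ι (euler (q ^ 3)) * (ι (euler (-q)) ^ 3 / ι (euler (-q ^ 3)))) := by
    field_simp
  rw [h6, hCC, hC, hC', hιD']
  field_simp
  ring

end dissections

/-! ### The relation of level 6, by cube roots of unity -/

section levelSix

open PowerSeries

variable {q : ℂ⟦X⟧}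

local notation "ι" => algebraMap ℂ⟦X⟧ (FractionRing ℂ⟦X⟧)

theorem exists_one_add_add_sq_eq_zero : ∃ w : ℂ, 1 + w + w ^ 2 = 0 := by
  obtain ⟨s, hs⟩ := IsAlgClosed.exists_pow_nat_eq (-3 : ℂ) two_pos
  exact ⟨(-1 + s) / 2, by linear_combination hs / 4⟩

/-- The relation `f₂⁹ f₃⁴ - f₁⁹ f₃ f₆³ = 9 q f₁⁴ f₂ f₆⁸`, at the cube of a power series. -/
theorem euler_level_six_cube (hq : constantCoeff q = 0) (hq0 : q ≠ 0) :
    euler (q ^ 6) ^ 9 * euler (q ^ 9) ^ 4 - euler (q ^ 3) ^ 9 * euler (q ^ 9) *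
      euler (q ^ 18) ^ 3 = 9 * q ^ 3 * euler (q ^ 3) ^ 4 * euler (q ^ 6) * euler (q ^ 18) ^ 8 := by
  obtain ⟨w, hw⟩ := exists_one_add_add_sq_eq_zero
  have hC : 1 + C w + C w ^ 2 = (0 : ℂ⟦X⟧) := by
    rw [← map_pow, ← map_one (C (R := ℂ)), ← map_add, ← map_add, hw, map_zero]
  have hw0 : C w ≠ (0 : ℂ⟦X⟧) := fun h => by simp [h] at hC
  have hw3 : (C w : ℂ⟦X⟧) ^ 3 = 1 := by linear_combination (C w - 1) * hC
  have hv : 1 + ι (C w) + ι (C w) ^ 2 = 0 := by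
    rw [← map_pow, ← map_one ι, ← map_add, ← map_add, hC, map_zero]
  have hfac : ∀ a b : FractionRing ℂ⟦X⟧,
      (a + b) * (a + ι (C w) * b) * (a + ι (C w) ^ 2 * b) = a ^ 3 + b ^ 3 := fun a b => by
    linear_combination (a ^ 2 * b + ι (C w) * a * b ^ 2 + (ι (C w) - 1) * b ^ 3) * hv
  have hk : ∀ k ≠ 0, constantCoeff (q ^ k) = 0 := fun k hk => by simp [hq, hk]
  have ne : ∀ k ≠ 0, ι (euler (q ^ k)) ≠ 0 := fun k h => algebraMap_euler_ne_zero (hk k h)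
  have hq1 : constantCoeff (C w * q) = 0 := by simp [hq]
  have hq2 : constantCoeff (C w ^ 2 * q) = 0 := by simp [hq]
  have hq10 : C w * q ≠ 0 := mul_ne_zero hw0 hq0
  have hq20 : C w ^ 2 * q ≠ 0 := mul_ne_zero (pow_ne_zero 2 hw0) hq0
  have n0 := algebraMap_euler_ne_zero hq
  have n1 := algebraMap_euler_ne_zero hq1
  have n2 := algebraMap_euler_ne_zero hq2
  have m0 := algebraMap_euler_ne_zero (hk 2 (by decide))
  have m1 := algebraMap_euler_ne_zero (q := C w * q ^ 2) (by simp [hq])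
  have m2 := algebraMap_euler_ne_zero (q := C w ^ 2 * q ^ 2) (by simp [hq])
  have s1 : (C w * q) ^ 2 = C w ^ 2 * q ^ 2 := mul_pow _ _ _
  have s2 : (C w ^ 2 * q) ^ 2 = C w * q ^ 2 := by linear_combination (C w * q ^ 2) * hw3
  have s3 : (C w * q) ^ 3 = q ^ 3 := by linear_combination (q ^ 3) * hw3
  have s4 : (C w ^ 2 * q) ^ 3 = q ^ 3 := by linear_combination (q ^ 3 * (C w ^ 3 + 1)) * hw3
  have s5 : (C w * q) ^ 9 = q ^ 9 := by
    rw [show 9 = 3 * 3 from rfl, pow_mul, s3, ← pow_mul]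
  have s6 : (C w ^ 2 * q) ^ 9 = q ^ 9 := by
    rw [show 9 = 3 * 3 from rfl, pow_mul, s4, ← pow_mul]
  have o3 : ∀ r : ℂ⟦X⟧, (-r) ^ 3 = -r ^ 3 := fun r => Odd.neg_pow (by decide) r
  have o9 : ∀ r : ℂ⟦X⟧, (-r) ^ 9 = -r ^ 9 := fun r => Odd.neg_pow (by decide) r
  have U := congrArg ι (euler_cube hw hq)
  have V := congrArg ι (euler_cube hw (hk 2 (by decide)))
  have a0 := congrArg ι (thetaPsi_eq_add hq)
  have a1 := congrArg ι (thetaPsi_eq_add hq1)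
  have a2 := congrArg ι (thetaPsi_eq_add hq2)
  have b0 := congrArg ι (thetaPhi_eq_add (q := -q) (by simp [hq]))
  have b1 := congrArg ι (thetaPhi_eq_add (q := -(C w * q)) (by simp [hq]))
  have b2 := congrArg ι (thetaPhi_eq_add (q := -(C w ^ 2 * q)) (by simp [hq]))
  have g0 := algebraMap_thetaPsi hq hq0
  have g1 := algebraMap_thetaPsi hq1 hq10
  have g2 := algebraMap_thetaPsi hq2 hq20
  have h0 := algebraMap_thetaPhi_neg hq hq0
  have h1 := algebraMap_thetaPhi_neg hq1 hq10
  have h2 := algebraMap_thetaPhi_neg hq2 hq20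
  have c1 := algebraMap_thetaA (hk 3 (by decide)) (pow_ne_zero _ hq0)
  have c2 := algebraMap_thetaPsi (hk 9 (by decide)) (pow_ne_zero _ hq0)
  have c3 := algebraMap_thetaPhi_neg (hk 9 (by decide)) (pow_ne_zero _ hq0)
  have c4 := algebraMap_thetaOmega_neg (hk 3 (by decide)) (pow_ne_zero _ hq0)
  simp only [o3, o9, s1, s2, s3, s4, s5, s6, ← pow_mul, map_add, map_mul, map_neg,
    map_ofNat, map_pow] at U V a0 a1 a2 b0 b1 b2 g0 g1 g2 h0 h1 h2 c1 c2 c3 c4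
  norm_num at U V c1 c2 c3 c4
  rw [g0] at a0
  rw [g1] at a1
  rw [g2] at a2
  rw [h0] at b0
  rw [h1] at b1
  rw [h2] at b2
  have n3 := ne 3 (by decide)
  have n6 := ne 6 (by decide)
  have n9 := ne 9 (by decide)
  have n18 := ne 18 (by decide)
  have hU : ι (euler q) * ι (euler (C w * q)) * ι (euler (C w ^ 2 * q)) =
      ι (euler (q ^ 3)) ^ 4 / ι (euler (q ^ 9)) := by
    rw [eq_div_iff n9, U]
  have hV : ι (euler (q ^ 2)) * ι (euler (C w * q ^ 2)) * ι (euler (C w ^ 2 * q ^ 2)) =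
      ι (euler (q ^ 6)) ^ 4 / ι (euler (q ^ 18)) := by
    rw [eq_div_iff n18, V]
  -- Multiplying ψ(q) = A(q³) + qψ(q⁹) over q, wq, w²q gives A³ + q³ψ(q⁹)³ on one side and Euler
  -- products on the other; `k2` does the same for φ(-q).
  have k1 : 8 * (ι (euler (q ^ 6)) ^ 4 / ι (euler (q ^ 18))) ^ 2 /
      (ι (euler (q ^ 3)) ^ 4 / ι (euler (q ^ 9))) =
      8 * ι (thetaA (q ^ 3)) ^ 3 + ι q ^ 3 * ι (thetaPsi (q ^ 9)) ^ 3 := by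
    rw [← hU, ← hV]
    have e1 : 8 * (ι (euler (q ^ 2)) * ι (euler (C w * q ^ 2)) * ι (euler (C w ^ 2 * q ^ 2))) ^ 2 /
        (ι (euler q) * ι (euler (C w * q)) * ι (euler (C w ^ 2 * q))) =
        (2 * ι (euler (q ^ 2)) ^ 2 / ι (euler q)) *
        (2 * ι (euler (C w ^ 2 * q ^ 2)) ^ 2 / ι (euler (C w * q))) *
        (2 * ι (euler (C w * q ^ 2)) ^ 2 / ι (euler (C w ^ 2 * q))) := by
      field_simp
      norm_num
    rw [e1, a0, a1, a2]
    have e2 := hfac (2 * ι (thetaA (q ^ 3))) (ι q * ι (thetaPsi (q ^ 9)))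
    linear_combination e2
  have k2 : (ι (euler (q ^ 3)) ^ 4 / ι (euler (q ^ 9))) ^ 2 /
      (ι (euler (q ^ 6)) ^ 4 / ι (euler (q ^ 18))) =
      ι (thetaPhi (-q ^ 9)) ^ 3 - 8 * ι q ^ 3 * ι (thetaOmega (-q ^ 3)) ^ 3 := by
    rw [← hU, ← hV]
    have e1 : (ι (euler q) * ι (euler (C w * q)) * ι (euler (C w ^ 2 * q))) ^ 2 /
        (ι (euler (q ^ 2)) * ι (euler (C w * q ^ 2)) * ι (euler (C w ^ 2 * q ^ 2))) =
        (ι (euler q) ^ 2 / ι (euler (q ^ 2))) *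
        (ι (euler (C w * q)) ^ 2 / ι (euler (C w ^ 2 * q ^ 2))) *
        (ι (euler (C w ^ 2 * q)) ^ 2 / ι (euler (C w * q ^ 2))) := by
      field_simp
    rw [e1, b0, b1, b2]
    have e2 := hfac (ι (thetaPhi (-q ^ 9))) (-2 * ι q * ι (thetaOmega (-q ^ 3)))
    linear_combination e2
  rw [c1, c2] at k1
  rw [c3, c4] at k2
  apply IsFractionRing.injective ℂ⟦X⟧ (FractionRing ℂ⟦X⟧)
  simp only [map_mul, map_pow, map_ofNat, map_sub]
  field_simp at k1 k2
  refine mul_left_cancel₀ n18 ?_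
  -- The weights cancel the terms from A³ and φ(-q⁹)³. The remaining q³ terms are proportional, with
  -- weights 1 and 8, whence the 9.
  linear_combination (ι (euler (q ^ 6)) / 8) * k1 - ι (euler (q ^ 3)) * k2

end levelSix

/-! ### Substitutions q ↦ -q and q ↦ q^m, and passage from ℤ to ℂ -/

section coefficients

open PowerSeries

theorem continuous_of_continuous_coeff {R : Type*} [Semiring R] [TopologicalSpace R]
    {σ : R⟦X⟧ → ℂ⟦X⟧} (h : ∀ d, Continuous fun f => coeff d (σ f)) : Continuous σ :=
  continuous_iff_continuousAt.mpr fun f =>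
    (WithPiTopology.tendsto_iff_coeff_tendsto ℂ _ _ _).mpr fun d => (h d).tendsto f

theorem euler_eq_tprod (q : ℂ⟦X⟧) : euler q = ∏' j : ℕ, (1 - q ^ (j + 1)) :=
  tprod_congr fun j => by ring

theorem multipliable_euler {q : ℂ⟦X⟧} (hq : constantCoeff q = 0) :
    Multipliable fun j : ℕ => (1 - q ^ (j + 1)) :=
  (multipliable_one_add_of_X_pow_dvd (X_pow_dvd_mul_pow hq (-q))).congr fun j => by ring

theorem map_euler (σ : ℂ⟦X⟧ →+* ℂ⟦X⟧) (hσ : Continuous σ) {q : ℂ⟦X⟧}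
    (hq : constantCoeff q = 0) : σ (euler q) = euler (σ q) := by
  rw [euler_eq_tprod, euler_eq_tprod, (multipliable_euler hq).map_tprod σ hσ]
  simp

theorem rescale_neg_one_euler {k : ℕ} (hk : k ≠ 0) :
    rescale (-1) (euler (X ^ k : ℂ⟦X⟧)) = euler ((-X) ^ k) := by
  rw [map_euler _ (continuous_of_continuous_coeff fun d => ?_) (by simp [hk])]
  · simp [rescale_X]
  · simp only [coeff_rescale]
    exact continuous_const.mul (WithPiTopology.continuous_coeff ℂ d)

theorem expand_euler {m k : ℕ} (hm : m ≠ 0) (hk : k ≠ 0) :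
    expand m hm (euler (X ^ k : ℂ⟦X⟧)) = euler (X ^ (m * k)) := by
  have h := map_euler (expand m hm (R := ℂ)).toRingHom
    (continuous_of_continuous_coeff fun d => ?_) (q := X ^ k) (by simp [hk])
  · simpa [pow_mul] using h
  · simp only [AlgHom.toRingHom_eq_coe, RingHom.coe_coe, coeff_expand]
    split_ifs
    · exact WithPiTopology.continuous_coeff ℂ _
    · exact continuous_const

theorem map_eulerProduct {k : ℕ} (hk : 0 < k) :
    PowerSeries.map (Int.castRingHom ℂ) (eulerProduct k) = euler (X ^ k) := by
  rw [eulerProduct, (multipliable_eulerProduct hk).map_tprod _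
    (continuous_of_continuous_coeff fun d => ?_), euler_eq_tprod]
  · refine tprod_congr fun j => ?_
    simp [← pow_mul, mul_comm]
  · simp only [coeff_map]
    exact continuous_of_discreteTopology.comp (WithPiTopology.continuous_coeff ℤ d)

/-- B(q) - B(-q) is twice the odd part of B, so the hypothesis says that this odd part is q W(q²).
-/
theorem coeff_two_mul_add_one_of_sub_rescale {B W : ℂ⟦X⟧}
    (h : B - rescale (-1) B = 2 * X * expand 2 two_ne_zero W) (n : ℕ) :
    coeff (2 * n + 1) B = coeff n W := by
  have h1 := congrArg (coeff (2 * n + 1)) h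
  rw [mul_assoc, ← map_ofNat (C (R := ℂ)) 2, coeff_C_mul, coeff_succ_X_mul, coeff_expand_mul, map_sub,
    coeff_rescale, Odd.neg_one_pow ⟨n, rfl⟩] at h1
  linear_combination h1 / 2

/-- The relation `f₂⁹ f₃⁴ - f₁⁹ f₃ f₆³ = 9 q f₁⁴ f₂ f₆⁸` at `q = X ^ 2`. -/
theorem euler_level_six : euler (X ^ 4 : ℂ⟦X⟧) ^ 9 * euler (X ^ 6) ^ 4 -
    euler (X ^ 2) ^ 9 * euler (X ^ 6) * euler (X ^ 12) ^ 3 =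
    9 * X ^ 2 * euler (X ^ 2) ^ 4 * euler (X ^ 4) * euler (X ^ 12) ^ 8 := by
  have h := euler_level_six_cube (q := X) constantCoeff_X X_ne_zero
  -- The relation is known only at cubes. Since f(q) ↦ f(q³) is injective, it descends to q itself
  -- and can then be expanded to q².
  have hinj : Function.Injective (expand 3 three_ne_zero (R := ℂ)) := fun f g hfg => by
    ext n
    have := congrArg (coeff (3 * n)) hfg
    rwa [coeff_expand_mul, coeff_expand_mul] at this
  have h1 : euler (X ^ 2 : ℂ⟦X⟧) ^ 9 * euler (X ^ 3) ^ 4 -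
      euler (X ^ 1) ^ 9 * euler (X ^ 3) * euler (X ^ 6) ^ 3 =
      9 * X * euler (X ^ 1) ^ 4 * euler (X ^ 2) * euler (X ^ 6) ^ 8 := by
    apply hinj
    simp only [map_sub, map_mul, map_pow, map_ofNat, expand_X]
    rw [expand_euler _ (by decide), expand_euler _ (by decide), expand_euler _ (by decide),
      expand_euler _ (by decide)]
    exact h
  have h2 := congrArg (expand 2 two_ne_zero (R := ℂ)) h1
  simp only [map_sub, map_mul, map_pow, map_ofNat, expand_X] at h2
  rw [expand_euler _ (by decide), expand_euler _ (by decide), expand_euler _ (by decide),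
    expand_euler _ (by decide)] at h2
  exact h2

end coefficients

/-! ### The two extractions for the 9-regular partition function -/

section regular

open PowerSeries

local notation "ι" => algebraMap ℂ⟦X⟧ (FractionRing ℂ⟦X⟧)

/-- The 2-dissection of `f₉ / f₁`: its odd part. -/
theorem euler_nine_div_sub {q : ℂ⟦X⟧} (hq : constantCoeff q = 0) (hq0 : q ≠ 0) :
    ι (euler (q ^ 9)) / ι (euler q) - ι (euler (-q ^ 9)) / ι (euler (-q)) =
      2 * ι q * ι (euler (q ^ 4)) ^ 2 * ι (euler (q ^ 6)) * ι (euler (q ^ 36)) /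
        (ι (euler (q ^ 2)) ^ 3 * ι (euler (q ^ 12))) := by
  have hk : ∀ k ≠ 0, constantCoeff (q ^ k) = 0 := fun k hk => by simp [hq, hk]
  have ne : ∀ k ≠ 0, ι (euler (q ^ k)) ≠ 0 := fun k h => algebraMap_euler_ne_zero (hk k h)
  have a := euler_psi_three_dissection hq hq0
  have a' := euler_psi_three_dissection (q := -q) (by simp [hq]) (by simpa using hq0)
  have b := euler_psi_three_dissection (hk 2 (by decide)) (pow_ne_zero _ hq0)
  have c := euler_cube_div_sub (hk 3 (by decide)) (pow_ne_zero _ hq0)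
  rw [Even.neg_pow (n := 2) (by decide), Even.neg_pow (n := 6) (by decide),
    Even.neg_pow (n := 18) (by decide), Odd.neg_pow (n := 3) (by decide),
    Odd.neg_pow (n := 9) (by decide), map_neg] at a'
  simp only [← pow_mul, map_pow] at b c
  norm_num at b c
  have n1 := algebraMap_euler_ne_zero hq
  have n1' := algebraMap_euler_ne_zero (q := -q) (by simp [hq])
  have n3' := algebraMap_euler_ne_zero (q := -q ^ 3) (by simp [hq])
  have n9' := algebraMap_euler_ne_zero (q := -q ^ 9) (by simp [hq])
  have n2 := ne 2 (by decide)
  have n3 := ne 3 (by decide)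
  have n4 := ne 4 (by decide)
  have n6 := ne 6 (by decide)
  have n9 := ne 9 (by decide)
  have n12 := ne 12 (by decide)
  have n18 := ne 18 (by decide)
  have n36 := ne 36 (by decide)
  have h1 : ι (euler (q ^ 9)) / ι (euler q) = ι (euler (q ^ 6)) / (ι (euler (q ^ 18)) *
      ι (euler (q ^ 2)) ^ 2) * (ι (euler (q ^ 9)) ^ 3 / ι (euler (q ^ 3))) +
      ι q * ι (euler (q ^ 18)) ^ 2 / ι (euler (q ^ 2)) ^ 2 := by
    have : ι (euler (q ^ 9)) / ι (euler q) = ι (euler (q ^ 9)) / ι (euler (q ^ 2)) ^ 2 *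
        (ι (euler (q ^ 2)) ^ 2 / ι (euler q)) := by
      field_simp
    rw [this, a]
    field_simp
  have h1' : ι (euler (-q ^ 9)) / ι (euler (-q)) = ι (euler (q ^ 6)) / (ι (euler (q ^ 18)) *
      ι (euler (q ^ 2)) ^ 2) * (ι (euler (-q ^ 9)) ^ 3 / ι (euler (-q ^ 3))) -
      ι q * ι (euler (q ^ 18)) ^ 2 / ι (euler (q ^ 2)) ^ 2 := by
    have : ι (euler (-q ^ 9)) / ι (euler (-q)) = ι (euler (-q ^ 9)) / ι (euler (q ^ 2)) ^ 2 *
        (ι (euler (q ^ 2)) ^ 2 / ι (euler (-q))) := by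
      field_simp
    rw [this, a']
    field_simp
    ring
  -- The two odd contributions, 2q f₁₈²/f₂² and the one with f₃₆³/f₁₂, are a common multiple of the
  -- two terms of the 3-dissection `b` of ψ(q²).
  have h2 : ι (euler (q ^ 9)) / ι (euler q) - ι (euler (-q ^ 9)) / ι (euler (-q)) =
      2 * ι q * ι (euler (q ^ 6)) * ι (euler (q ^ 36)) / (ι (euler (q ^ 12)) *
      ι (euler (q ^ 2)) ^ 2) * (ι (euler (q ^ 4)) ^ 2 / ι (euler (q ^ 2))) := by
    rw [h1, h1', b, ← sub_eq_zero]
    rw [sub_eq_iff_eq_add] at c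
    rw [c]
    field_simp
    ring
  rw [h2]
  field_simp

/-- The odd part of `f₂² f₃ f₁₈ / (f₁³ f₆)`. -/
theorem euler_eighteen_div_sub :
    ι (euler (X ^ 2)) ^ 2 * ι (euler (X ^ 3)) * ι (euler (X ^ 18)) /
        (ι (euler X) ^ 3 * ι (euler (X ^ 6))) -
      ι (euler (X ^ 2)) ^ 2 * ι (euler (-X ^ 3)) * ι (euler (X ^ 18)) /
        (ι (euler (-X)) ^ 3 * ι (euler (X ^ 6))) =
      6 * ι X * ι (euler (X ^ 4)) ^ 2 * ι (euler (X ^ 12)) ^ 2 * ι (euler (X ^ 18)) /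
        ι (euler (X ^ 2)) ^ 5 := by
  have h := euler_div_cube_sub constantCoeff_X X_ne_zero euler_level_six
  have ne : ∀ k ≠ 0, ι (euler (X ^ k)) ≠ 0 := fun k h => algebraMap_euler_ne_zero (by simp [h])
  have n2 := ne 2 (by decide)
  have n6 := ne 6 (by decide)
  -- f₂² f₁₈/f₆ is even, so it factors out of the odd part.
  have h1 : ι (euler (X ^ 2)) ^ 2 * ι (euler (X ^ 3)) * ι (euler (X ^ 18)) /
        (ι (euler X) ^ 3 * ι (euler (X ^ 6))) -
      ι (euler (X ^ 2)) ^ 2 * ι (euler (-X ^ 3)) * ι (euler (X ^ 18)) /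
        (ι (euler (-X)) ^ 3 * ι (euler (X ^ 6))) =
      ι (euler (X ^ 2)) ^ 2 * ι (euler (X ^ 18)) / ι (euler (X ^ 6)) *
      (ι (euler (X ^ 3)) / ι (euler X) ^ 3 - ι (euler (-X ^ 3)) / ι (euler (-X)) ^ 3) := by
    ring
  rw [h1, h]
  field_simp

/-- By Glaisher's theorem, 9-regular partitions are equinumerous with those whose parts each occur
fewer than 9 times. Their generating function is a product of finite geometric sums (1 - q^(9i))/(1
- q^i). -/
theorem mk_regularPartitionCount_mul_euler :
    (PowerSeries.mk fun n => (regularPartitionCount 9 n : ℂ)) * euler X = euler (X ^ 9) := by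
  have h1 : (PowerSeries.mk fun n => (regularPartitionCount 9 n : ℂ)) =
      ∏' i, ∑ j ∈ Finset.range 9, X ^ ((i + 1) * j) := by
    rw [← Nat.Partition.powerSeriesMk_card_countRestricted_eq_tprod ℂ (by decide : 0 < 9),
      ← Nat.Partition.powerSeriesMk_card_restricted_eq_powerSeriesMk_card_countRestricted ℂ
        (by decide : 0 < 9)]
    rfl
  rw [h1, euler_eq_tprod, euler_eq_tprod,
    ← (Nat.Partition.multipliable_powerSeriesMk_card_countRestricted ℂ 9).tprod_mul
      (multipliable_euler constantCoeff_X)]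
  refine tprod_congr fun j => ?_
  simp_rw [pow_mul]
  rw [geom_sum_mul_neg, ← pow_mul, ← pow_mul, mul_comm]

/-- The generating function of `b₉(2n + 1)` is `f₂² f₃ f₁₈ / (f₁³ f₆)`. -/
theorem regularPartitionCount_two_mul_add_one (n : ℕ) :
    (regularPartitionCount 9 (2 * n + 1) : ℂ) = coeff n (euler (X ^ 2) ^ 2 * euler (X ^ 3) *
      euler (X ^ 18) * (euler X ^ 3 * euler (X ^ 6) : ℂ⟦X⟧)⁻¹) := by
  have hk : ∀ k ≠ 0, constantCoeff (X ^ k : ℂ⟦X⟧) = 0 := fun k hk => by simp [hk]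
  have ne : ∀ k ≠ 0, ι (euler (X ^ k)) ≠ 0 := fun k h => algebraMap_euler_ne_zero (hk k h)
  have n1 := algebraMap_euler_ne_zero (constantCoeff_X (R := ℂ))
  have n1' := algebraMap_euler_ne_zero (q := -X) (by simp)
  set B : ℂ⟦X⟧ := PowerSeries.mk fun n => (regularPartitionCount 9 n : ℂ) with hB
  have hB1 := mk_regularPartitionCount_mul_euler
  rw [← hB] at hB1
  have hB2 := congrArg (rescale (-1)) hB1
  have r1 := rescale_neg_one_euler one_ne_zero
  rw [pow_one, pow_one] at r1
  rw [map_mul, r1, rescale_neg_one_euler (by decide), Odd.neg_pow (by decide)] at hB2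
  set W := euler (X ^ 2) ^ 2 * euler (X ^ 3) * euler (X ^ 18) * (euler X ^ 3 * euler (X ^ 6))⁻¹
    with hW
  have hW1 : W * (euler X ^ 3 * euler (X ^ 6)) = euler (X ^ 2) ^ 2 * euler (X ^ 3) *
      euler (X ^ 18) := by
    rw [hW, mul_assoc, PowerSeries.inv_mul_cancel, mul_one]
    simp [constantCoeff_euler]
  have hW2 := congrArg (expand 2 two_ne_zero (R := ℂ)) hW1
  have x1 := expand_euler two_ne_zero one_ne_zero
  rw [pow_one] at x1
  simp only [map_mul, map_pow] at hW2
  rw [x1, expand_euler _ (by decide), expand_euler _ (by decide), expand_euler _ (by decide),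
    expand_euler _ (by decide)] at hW2
  norm_num at hW2
  have key : B - rescale (-1) B = 2 * X * expand 2 two_ne_zero W := by
    apply IsFractionRing.injective ℂ⟦X⟧ (FractionRing ℂ⟦X⟧)
    have e1 : ι B = ι (euler (X ^ 9)) / ι (euler X) := by
      rw [eq_div_iff n1, ← map_mul, hB1]
    have e2 : ι (rescale (-1) B) = ι (euler (-X ^ 9)) / ι (euler (-X)) := by
      rw [eq_div_iff n1', ← map_mul, hB2]
    have e3 : ι (expand 2 two_ne_zero W) = ι (euler (X ^ 4)) ^ 2 * ι (euler (X ^ 6)) *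
        ι (euler (X ^ 36)) / (ι (euler (X ^ 2)) ^ 3 * ι (euler (X ^ 12))) := by
      rw [eq_div_iff (mul_ne_zero (pow_ne_zero 3 (ne 2 (by decide))) (ne 12 (by decide)))]
      simp only [← map_mul, ← map_pow, hW2]
    rw [map_sub, map_mul, map_mul, map_ofNat, e1, e2, e3, euler_nine_div_sub constantCoeff_X X_ne_zero]
    ring
  rw [← coeff_two_mul_add_one_of_sub_rescale key n, hB, coeff_mk]

/-- The generating function of `b₉(4n + 3)` is `3 f₂² f₆² f₉ / f₁⁵`. -/
theorem regularPartitionCount_four_mul_add_three (n : ℕ) :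
    (regularPartitionCount 9 (4 * n + 3) : ℂ) = coeff n (3 * (euler (X ^ 2) ^ 2 *
      euler (X ^ 6) ^ 2 * euler (X ^ 9)) * (euler X ^ 5 : ℂ⟦X⟧)⁻¹) := by
  have hk : ∀ k ≠ 0, constantCoeff (X ^ k : ℂ⟦X⟧) = 0 := fun k hk => by simp [hk]
  have ne : ∀ k ≠ 0, ι (euler (X ^ k)) ≠ 0 := fun k h => algebraMap_euler_ne_zero (hk k h)
  have n1 := algebraMap_euler_ne_zero (constantCoeff_X (R := ℂ))
  have n1' := algebraMap_euler_ne_zero (q := -X) (by simp)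
  have n6 := ne 6 (by decide)
  rw [show 4 * n + 3 = 2 * (2 * n + 1) + 1 by ring, regularPartitionCount_two_mul_add_one]
  set B := euler (X ^ 2) ^ 2 * euler (X ^ 3) * euler (X ^ 18) * (euler X ^ 3 * euler (X ^ 6))⁻¹
    with hB
  have hB1 : B * (euler X ^ 3 * euler (X ^ 6)) = euler (X ^ 2) ^ 2 * euler (X ^ 3) *
      euler (X ^ 18) := by
    rw [hB, mul_assoc, PowerSeries.inv_mul_cancel, mul_one]
    simp [constantCoeff_euler]
  have hB2 := congrArg (rescale (-1)) hB1
  have r1 := rescale_neg_one_euler one_ne_zero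
  rw [pow_one, pow_one] at r1
  simp only [map_mul, map_pow] at hB2
  rw [r1, rescale_neg_one_euler (by decide), rescale_neg_one_euler (by decide),
    rescale_neg_one_euler (by decide), rescale_neg_one_euler (by decide),
    Even.neg_pow (n := 2) (by decide), Even.neg_pow (n := 6) (by decide),
    Even.neg_pow (n := 18) (by decide), Odd.neg_pow (n := 3) (by decide)] at hB2
  set W := 3 * (euler (X ^ 2) ^ 2 * euler (X ^ 6) ^ 2 * euler (X ^ 9)) * (euler X ^ 5 : ℂ⟦X⟧)⁻¹
    with hW
  have hW1 : W * euler X ^ 5 = 3 * (euler (X ^ 2) ^ 2 * euler (X ^ 6) ^ 2 * euler (X ^ 9)) := by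
    rw [hW, mul_assoc, PowerSeries.inv_mul_cancel, mul_one]
    simp [constantCoeff_euler]
  have hW2 := congrArg (expand 2 two_ne_zero (R := ℂ)) hW1
  have x1 := expand_euler two_ne_zero one_ne_zero
  rw [pow_one] at x1
  simp only [map_mul, map_pow, map_ofNat] at hW2
  rw [x1, expand_euler _ (by decide), expand_euler _ (by decide), expand_euler _ (by decide)] at hW2
  norm_num at hW2
  refine coeff_two_mul_add_one_of_sub_rescale ?_ n
  apply IsFractionRing.injective ℂ⟦X⟧ (FractionRing ℂ⟦X⟧)
  have e1 : ι B = ι (euler (X ^ 2)) ^ 2 * ι (euler (X ^ 3)) * ι (euler (X ^ 18)) /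
      (ι (euler X) ^ 3 * ι (euler (X ^ 6))) := by
    rw [eq_div_iff (mul_ne_zero (pow_ne_zero 3 n1) n6)]
    simp only [← map_mul, ← map_pow, hB1]
  have e2 : ι (rescale (-1) B) = ι (euler (X ^ 2)) ^ 2 * ι (euler (-X ^ 3)) * ι (euler (X ^ 18)) /
      (ι (euler (-X)) ^ 3 * ι (euler (X ^ 6))) := by
    rw [eq_div_iff (mul_ne_zero (pow_ne_zero 3 n1') n6)]
    simp only [← map_mul, ← map_pow, hB2]
  have e3 : ι (expand 2 two_ne_zero W) = 3 * (ι (euler (X ^ 4)) ^ 2 * ι (euler (X ^ 12)) ^ 2 *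
      ι (euler (X ^ 18))) / ι (euler (X ^ 2)) ^ 5 := by
    rw [eq_div_iff (pow_ne_zero 5 (ne 2 (by decide)))]
    simp only [← map_mul, ← map_pow, hW2, ← map_ofNat ι]
  rw [map_sub, e1, e2, map_mul, map_mul, map_ofNat, e3, euler_eighteen_div_sub]
  ring

end regular

/-! ### The identity over ℤ and the congruence -/

theorem theorem6 :
    (PowerSeries.mk fun n : ℕ => (regularPartitionCount 9 (4 * n + 3) : ℤ)) =
        3 * (eulerProduct 2 ^ 2 * eulerProduct 6 ^ 2 * eulerProduct 9) *
          PowerSeries.invOfUnit (eulerProduct 1 ^ 5) 1 ∧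
      ∀ n : ℕ, regularPartitionCount 9 (4 * n + 3) ≡ 0 [MOD 3] := by
  have hunit : eulerProduct 1 ^ 5 * PowerSeries.invOfUnit (eulerProduct 1 ^ 5) 1 = 1 :=
    PowerSeries.mul_invOfUnit _ _ (by simp [constantCoeff_eulerProduct])
  have hmain : (PowerSeries.mk fun n : ℕ => (regularPartitionCount 9 (4 * n + 3) : ℤ)) *
      eulerProduct 1 ^ 5 = 3 * (eulerProduct 2 ^ 2 * eulerProduct 6 ^ 2 * eulerProduct 9) := by
    -- With the denominator cleared, the identity can be checked over ℂ, where cube roots of unity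
    -- were available.
    apply PowerSeries.map_injective (Int.castRingHom ℂ) Int.cast_injective
    simp only [map_mul, map_pow, map_ofNat]
    rw [map_eulerProduct (by decide), map_eulerProduct (by decide), map_eulerProduct (by decide),
      map_eulerProduct (by decide), pow_one]
    have h : PowerSeries.map (Int.castRingHom ℂ)
        (PowerSeries.mk fun n : ℕ => (regularPartitionCount 9 (4 * n + 3) : ℤ)) =
        3 * (euler (PowerSeries.X ^ 2) ^ 2 * euler (PowerSeries.X ^ 6) ^ 2 *
          euler (PowerSeries.X ^ 9)) * (euler PowerSeries.X ^ 5)⁻¹ := by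
      ext n
      rw [← regularPartitionCount_four_mul_add_three]
      simp
    rw [h, mul_assoc, PowerSeries.inv_mul_cancel, mul_one]
    simp [constantCoeff_euler]
  have hgen : (PowerSeries.mk fun n : ℕ => (regularPartitionCount 9 (4 * n + 3) : ℤ)) =
      3 * (eulerProduct 2 ^ 2 * eulerProduct 6 ^ 2 * eulerProduct 9) *
        PowerSeries.invOfUnit (eulerProduct 1 ^ 5) 1 := by
    rw [← hmain, mul_assoc, hunit, mul_one]
  refine ⟨hgen, fun n => ?_⟩
  have h := congrArg (PowerSeries.coeff n) hgen
  rw [PowerSeries.coeff_mk, mul_assoc, ← map_ofNat (PowerSeries.C (R := ℤ)) 3,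
    PowerSeries.coeff_C_mul] at h
  rw [Nat.modEq_zero_iff_dvd]
  exact_mod_cast Dvd.intro _ h.symm
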